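/- All vector spaces are real and finite-dimensional. An abstract state space is a pair $(A,u_A)$, where $A$ is ordered by a closed, pointed, generating convex cone $A_+$ and $u_A\in A^*$ satisfies $u_A(\alpha)>0$ for all $0\neq\alpha\in A_+$; let $A^*_+$ be the cone of functionals that are nonnegative on $A_+$. The maximal tensor product $A\otimes_{\max}B$ is the space of bilinear forms on $A^*\times B^*$ ($\cong A\otimes B$), ordered by the cone of forms $\omega$ with $\omega(a,b)\ge 0$ for all $a\in A^*_+$, $b\in B^*_+$, with order unit $\omega\mapsto\omega(u_A,u_B)$; a bipartite state is an element $\omega$ of this cone with $\omega(u_A,u_B)=1$. Define $\hat\omega:A^*\to B$ by $b(\hat\omega(a))=\omega(a,b)$, and let $\omega^B=\hat\omega(u_A)$ be the $B$-marginal. A bipartite state $\omega$ is steering for its $B$-marginal if for every finite family $(\beta_i)$ in $B_+$ with $\sum_i\beta_i=\omega^B$ there are $x_i\in A^*_+$ with $\sum_i x_i=u_A$ and $\hat\omega(x_i)=\beta_i$ for all $i$; steering for its $A$-marginal is defined symmetrically. The steering product $A\otimes_{\mathrm{str}}B$ is the same space of bilinear forms, with the same order unit, ordered by the convex cone generated by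 all steering bipartite states. Here "steering" may be read as steering for the $B$-marginal, steering for at least one marginal, or steering for both marginals. A space ordered by a cone $C\subseteq V$ is weakly self-dual if there is a linear isomorphism $\eta:V^*\to V$ with $\eta(f)\in C$ if and only if $f$ is nonnegative on $C$. **Fact.** Let $A=B=\mathcal L_h(\mathbb C^2)$ be the qubit: the Hermitian $2\times2$ complex matrices, ordered by the cone of positive semidefinite matrices, with $u_A=u_B=\operatorname{Tr}$. Then, under each of the three readings of "steering", $$A\otimes_{\mathrm{str}}B = A\otimes_{\max}B ,$$ and this ordered space is not weakly self-dual. That is, neither $A\otimes_{\max}B$ nor $A\otimes_{\mathrm{str}}B$ is weakly self-dual. -/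

import Mathlib

open scoped Topology ComplexOrder

namespace SteeringProduct

open Module

/-- A real vector space with a convex cone `V₊` of positive vectors and a
distinguished functional (the candidate order unit *on* the space). -/
@[ext]
structure UnitalConeSpace (V : Type*) [AddCommGroup V] [Module ℝ V] where
  /-- The positive cone `V₊`. -/
  cone : PointedCone ℝ V
  /-- The distinguished functional `u`. -/
  unit : Dual ℝ V

/-- An abstract state space `(V, u)`: a finite-dimensional ordered linear space whose positive cone
is regular (pointed, generating, closed), with a strictly positive functional `u`.
Closedness refers to the canonical vector space topology of a finite-dimensional real space. -/
structure AbstractStateSpace (V : Type*) [AddCommGroup V] [Module ℝ V] [FiniteDimensional ℝ V]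
    extends UnitalConeSpace V where
  pointed : ∀ x, x ∈ cone → -x ∈ cone → x = 0
  generating : ∀ x, ∃ y ∈ cone, ∃ z ∈ cone, x = y - z
  closed : IsClosed[moduleTopology ℝ V] (cone : Set V)
  unit_pos : ∀ x ∈ cone, x ≠ 0 → 0 < unit x

section General

variable {V W : Type*} [AddCommGroup V] [Module ℝ V] [AddCommGroup W] [Module ℝ W]

/-- The dual cone `V*₊` of positive functionals. -/
def dualCone (C : PointedCone ℝ V) : PointedCone ℝ (Dual ℝ V) :=
  PointedCone.dual (Dual.eval ℝ V) (C : Set V)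

/-- The linear space `V`, ordered by the cone `C`, is weakly self-dual: there is an
order isomorphism `V* ≃ V`. -/
def WeaklySelfDual (C : PointedCone ℝ V) : Prop :=
  ∃ η : Dual ℝ V ≃ₗ[ℝ] V, ∀ f : Dual ℝ V, η f ∈ C ↔ f ∈ dualCone C

/-- Bilinear forms on `V* × W*`; in finite dimensions this is (isomorphic to) `V ⊗ W`. -/
abbrev Bilin (V W : Type*) [AddCommGroup V] [Module ℝ V] [AddCommGroup W] [Module ℝ W] : Type _ :=
  Dual ℝ V →ₗ[ℝ] Dual ℝ W →ₗ[ℝ] ℝ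

/-- The linear map `ω̂ : V* → W` of a bilinear form `ω` on `V* × W*`, i.e. the map with
`b (ω̂ a) = ω (a, b)`, where `W** = W`. -/
noncomputable def hat [FiniteDimensional ℝ W] (ω : Bilin V W) : Dual ℝ V →ₗ[ℝ] W :=
  (evalEquiv ℝ W).symm.toLinearMap ∘ₗ ω

theorem apply_hat [FiniteDimensional ℝ W] (ω : Bilin V W) (a : Dual ℝ V) (b : Dual ℝ W) :
    b (hat ω a) = ω a b := by
  simp [hat]

variable [FiniteDimensional ℝ V] [FiniteDimensional ℝ W]

/-- An effect on `A`: a functional `a` with `0 ≤ a ≤ u_A`. -/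
def IsEffect (A : AbstractStateSpace V) (a : Dual ℝ V) : Prop :=
  a ∈ dualCone A.cone ∧ A.unit - a ∈ dualCone A.cone

/-- A (finite) observable on `A`: a finite family of effects summing to `u_A`. -/
def IsObservable (A : AbstractStateSpace V) {n : ℕ} (x : Fin n → Dual ℝ V) : Prop :=
  (∀ i, IsEffect A (x i)) ∧ ∑ i, x i = A.unit

/-- An ensemble for `β`: a finite family of positive vectors summing to `β`. -/
def IsEnsemble (B : AbstractStateSpace W) (β : W) {n : ℕ} (b : Fin n → W) : Prop :=
  (∀ i, b i ∈ B.cone) ∧ ∑ i, b i = β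

/-- The maximal tensor product: bilinear forms on `A* × B*`, ordered by the cone of forms that are
nonnegative on pairs of positive functionals, with order unit `ω ↦ ω (u_A, u_B)`. -/
def maxTensor (A : AbstractStateSpace V) (B : AbstractStateSpace W) :
    UnitalConeSpace (Bilin V W) where
  cone :=
    { carrier := {ω | ∀ a ∈ dualCone A.cone, ∀ b ∈ dualCone B.cone, 0 ≤ ω a b}
      zero_mem' := fun _ _ _ _ => le_refl _
      add_mem' := fun h₁ h₂ a ha b hb => add_nonneg (h₁ a ha b hb) (h₂ a ha b hb)
      smul_mem' := fun c _ h a ha b hb => mul_nonneg c.2 (h a ha b hb) }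
  unit :=
    { toFun := fun ω => ω A.unit B.unit
      map_add' := fun _ _ => rfl
      map_smul' := fun _ _ => rfl }

/-- A (normalized) bipartite state in the maximal tensor product. -/
def IsBipartiteState (A : AbstractStateSpace V) (B : AbstractStateSpace W) (ω : Bilin V W) : Prop :=
  ω ∈ (maxTensor A B).cone ∧ (maxTensor A B).unit ω = 1

/-- `ω` is steering for its `B`-marginal `ω^B = ω̂ (u_A)`: every ensemble for `ω^B` is of the form
`ω̂ (x_i)` for an observable `(x_i)` on `A`. -/
def SteersSecond (A : AbstractStateSpace V) (B : AbstractStateSpace W) (ω : Bilin V W) : Prop :=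
  ∀ (n : ℕ) (b : Fin n → W), IsEnsemble B (hat ω A.unit) b →
    ∃ x : Fin n → Dual ℝ V, IsObservable A x ∧ ∀ i, hat ω (x i) = b i

/-- `ω` is steering for its `A`-marginal. -/
def SteersFirst (A : AbstractStateSpace V) (B : AbstractStateSpace W) (ω : Bilin V W) : Prop :=
  SteersSecond B A ω.flip

/-- The space of bilinear forms ordered by the cone generated by all bipartite states in the
maximal tensor product that satisfy `P`, with order unit `ω ↦ ω (u_A, u_B)`. -/
def productGeneratedBy (A : AbstractStateSpace V) (B : AbstractStateSpace W)
    (P : Bilin V W → Prop) : UnitalConeSpace (Bilin V W) where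
  cone := PointedCone.hull ℝ {ω | IsBipartiteState A B ω ∧ P ω}
  unit := (maxTensor A B).unit

/-- The steering product, where "steering" means steering for the `B`-marginal. -/
def steeringProduct (A : AbstractStateSpace V) (B : AbstractStateSpace W) :
    UnitalConeSpace (Bilin V W) :=
  productGeneratedBy A B (SteersSecond A B)

/-- The steering product, where "steering" means steering for at least one marginal. -/
def eitherSteeringProduct (A : AbstractStateSpace V) (B : AbstractStateSpace W) :
    UnitalConeSpace (Bilin V W) :=
  productGeneratedBy A B (fun ω => SteersFirst A B ω ∨ SteersSecond A B ω)

/-- The steering product, where "steering" means steering for both marginals (bisteering). -/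
def bisteeringProduct (A : AbstractStateSpace V) (B : AbstractStateSpace W) :
    UnitalConeSpace (Bilin V W) :=
  productGeneratedBy A B (fun ω => SteersFirst A B ω ∧ SteersSecond A B ω)

end General

section Quantum

/-- The real vector space of Hermitian `n × n` complex matrices. -/
abbrev Herm (n : Type*) [Fintype n] : Type _ := selfAdjoint (Matrix n n ℂ)

/-- The inclusion of the Hermitian matrices into all matrices, as a real linear map. -/
def hermIncl (n : Type*) [Fintype n] : Herm n →ₗ[ℝ] Matrix n n ℂ where
  toFun := fun a => a
  map_add' := fun _ _ => rfl
  map_smul' := fun _ _ => rfl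

instance (n : Type*) [Fintype n] : FiniteDimensional ℝ (Herm n) :=
  FiniteDimensional.of_injective (hermIncl n) Subtype.val_injective

variable (n : Type*) [Fintype n]

/-- The cone of positive semidefinite Hermitian matrices. -/
def psdCone : PointedCone ℝ (Herm n) where
  carrier := {a | (a : Matrix n n ℂ).PosSemidef}
  zero_mem' := Matrix.PosSemidef.zero
  add_mem' := fun h₁ h₂ => h₁.add h₂
  smul_mem' := fun c _ h => h.smul c.2

/-- The trace functional on Hermitian matrices. -/
def traceFunctional : Dual ℝ (Herm n) where
  toFun := fun a => (Matrix.trace (a : Matrix n n ℂ)).re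
  map_add' := fun a b => by simp
  map_smul' := fun c a => by simp

/-- The state space of a quantum system with Hilbert space `ℂⁿ`: Hermitian matrices, ordered by
positive semidefiniteness, with the trace as order unit. -/
def quantumStateSpace : AbstractStateSpace (Herm n) where
  cone := psdCone n
  unit := traceFunctional n
  pointed := by
    intro x hx hx'
    have h₁ : (x : Matrix n n ℂ).PosSemidef := hx
    have h₂ : (-(x : Matrix n n ℂ)).PosSemidef := hx'
    have h₃ := h₂.trace_nonneg
    rw [Matrix.trace_neg] at h₃
    exact Subtype.ext (h₁.trace_eq_zero_iff.mp
      (le_antisymm (neg_nonneg.mp h₃) h₁.trace_nonneg))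
  generating := by
    classical
    intro x
    have key : ∀ y : Herm n, ((y : Matrix n n ℂ) * (y : Matrix n n ℂ)).PosSemidef := by
      intro y
      have h := Matrix.posSemidef_conjTranspose_mul_self (y : Matrix n n ℂ)
      have h' : (y : Matrix n n ℂ).conjTranspose = y := y.2
      rwa [h'] at h
    let sq : Herm n → Herm n := fun y => ⟨(y : Matrix n n ℂ) * y, (key y).1⟩
    refine ⟨sq ((1 / 2 : ℝ) • (x + 1)), key _, sq ((1 / 2 : ℝ) • (x - 1)), key _, ?_⟩
    ext1
    simp only [sq, AddSubgroupClass.coe_sub, selfAdjoint.val_smul, AddSubgroup.coe_add,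
      selfAdjoint.val_one, smul_mul_assoc, mul_smul_comm, smul_smul, ← smul_sub]
    have : ((x : Matrix n n ℂ) + 1) * ((x : Matrix n n ℂ) + 1) -
        ((x : Matrix n n ℂ) - 1) * ((x : Matrix n n ℂ) - 1) = (4 : ℝ) • (x : Matrix n n ℂ) := by
      have h4 : (4 : ℝ) • (x : Matrix n n ℂ) = 4 * (x : Matrix n n ℂ) := by
        rw [ofNat_smul_eq_nsmul, nsmul_eq_mul]; norm_num
      rw [h4]
      noncomm_ring
    rw [this, smul_smul]
    norm_num
  closed := by
    let _ : TopologicalSpace (Herm n) := moduleTopology ℝ (Herm n)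
    have _ : IsModuleTopology ℝ (Herm n) := ⟨rfl⟩
    have hc : Continuous (hermIncl n) := IsModuleTopology.continuous_of_linearMap _
    have hset : (psdCone n : Set (Herm n)) =
        ⋂ v : n → ℂ, {a | 0 ≤ (star v ⬝ᵥ (hermIncl n a).mulVec v).re} := by
      ext a
      simp only [Set.mem_iInter]
      constructor
      · intro h v
        have h' : (a : Matrix n n ℂ).PosSemidef := h
        exact (Complex.nonneg_iff.mp (h'.dotProduct_mulVec_nonneg v)).1
      · intro h
        have ha : (a : Matrix n n ℂ).IsHermitian := a.2
        refine Matrix.PosSemidef.of_dotProduct_mulVec_nonneg ha fun v => ?_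
        refine Complex.nonneg_iff.mpr ⟨h v, ?_⟩
        exact (ha.im_star_dotProduct_mulVec_self v).symm
    rw [hset]
    refine isClosed_iInter fun v => isClosed_le continuous_const ?_
    exact Complex.continuous_re.comp
      (continuous_const.dotProduct (hc.matrix_mulVec continuous_const))
  unit_pos := by
    intro x hx hx0
    have h₁ : (x : Matrix n n ℂ).PosSemidef := hx
    have h₂ := Complex.nonneg_iff.mp h₁.trace_nonneg
    refine lt_of_le_of_ne h₂.1 fun h => hx0 (Subtype.ext (h₁.trace_eq_zero_iff.mp ?_))
    exact Complex.ext h.symm h₂.2.symm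

/-- The qubit `ℒ_h(ℂ²)`. -/
def qubit : AbstractStateSpace (Herm (Fin 2)) := quantumStateSpace (Fin 2)

end Quantum

end SteeringProduct

namespace SteeringProduct
open Module

/-! In Pauli coordinates the qubit cone is the Lorentz cone of four-dimensional Minkowski space,
which the Minkowski form makes self-dual. Two-qubit bilinear forms become `4 × 4` matrices, the
maximal tensor cone becomes the cone of maps preserving the Lorentz cone, and exchanging the factors
becomes the Minkowski adjoint.

A map `T` sending nonzero cone vectors into the open cone has a timelike critical direction `x` for
the ratio of `⟨x, x⟩` to `⟨T x, T x⟩`. Lorentz transformations that carry `x` and `T x` to the time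
axis reduce a multiple of `T` to a block matrix `1 ⊕ M` with `M` a contraction, and a contraction is
a mixture of orthogonal matrices. So `T` is a conic combination of orthochronous Lorentz maps
(`mem_hull_orthochronous`). Perturbing an arbitrary positive map and passing to the limit adds only
degenerate conformal maps of rank one; compactness of the normalized conformal maps keeps their hull
closed (`positiveMaps_le_hull`).

Normalized conformal maps steer (`exists_lift_of_mem_conformalBase`): a nondegenerate one has a
positive inverse, which pulls ensembles back, and a degenerate one has a null marginal, whose
ensembles are all proportional to it. The class is closed under adjoints, so every generator is
bisteering, and the three steering cones all equal the maximal one.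

For the failure of self-duality (`not_weaklySelfDual_positiveMaps`), the dual cone is generated by
the products `T ↦ ⟨b, T a⟩` with `a`, `b` null. An order isomorphism would match the identity, which
is extreme, with such a product. Then the maps `ketBra b w` with `w` null would correspond to
products of a null vector with itself. These depend linearly on `w`, but four null vectors with `w₁
+ w₂ = w₃ + w₄` give a linear relation that such squares cannot satisfy. -/

/-! ### Compact convex hulls and the bipolar theorem. -/

/-- In a finite-dimensional space, the convex hull of a compact set is compact. -/
theorem isCompact_convexHull_of_finiteDimensional {E : Type*} [NormedAddCommGroup E]
    [NormedSpace ℝ E] [FiniteDimensional ℝ E] {K : Set E} (hK : IsCompact K) :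
    IsCompact (convexHull ℝ K) := by
  classical
  rcases K.eq_empty_or_nonempty with rfl | ⟨p, hp⟩
  · simp
  let d := finrank ℝ E + 1
  have hc : IsCompact ((stdSimplex ℝ (Fin d)) ×ˢ (Set.univ.pi fun _ : Fin d => K)) :=
    (isCompact_stdSimplex ℝ (Fin d)).prod (isCompact_univ_pi fun _ => hK)
  have hcont : Continuous fun q : (Fin d → ℝ) × (Fin d → E) => ∑ i, q.1 i • q.2 i := by fun_prop
  convert! hc.image hcont using 1
  apply Set.Subset.antisymm
  · intro x hx
    obtain ⟨ι, _, z, w, hz, hind, hw, hsum, rfl⟩ := eq_pos_convex_span_of_mem_convexHull hx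
    have hcard : Fintype.card ι ≤ Fintype.card (Fin d) := by
      simpa [d] using hind.card_le_finrank_succ.trans
        (Nat.succ_le_succ (Submodule.finrank_le _))
    obtain ⟨e⟩ := Function.Embedding.nonempty_of_card_le hcard
    -- Carathéodory bounds the number of points by `d`; unused slots get weight `0` and the dummy
    -- point `p`.
    refine ⟨(fun i => if h : ∃ j, e j = i then w h.choose else 0,
      fun i => if h : ∃ j, e j = i then z h.choose else p), ⟨⟨?_, ?_⟩, ?_⟩, ?_⟩
    · intro i
      dsimp only
      split_ifs
      · exact (hw _).le
      · rfl
    · rw [← hsum]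
      refine (Fintype.sum_of_injective e e.injective _ _ ?_ ?_).symm
      · intro i hi
        exact dif_neg hi
      · intro j
        have h : ∃ j', e j' = e j := ⟨j, rfl⟩
        simp only [dif_pos h, e.injective h.choose_spec]
    · intro i _
      dsimp only
      split_ifs
      · exact hz ⟨_, rfl⟩
      · exact hp
    · refine (Fintype.sum_of_injective e e.injective _ _ ?_ ?_).symm
      · intro i hi
        have hi' : ¬ ∃ j, e j = i := hi
        simp [dif_neg hi']
      · intro j
        have h : ∃ j', e j' = e j := ⟨j, rfl⟩
        simp only [dif_pos h, e.injective h.choose_spec]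
  · rintro _ ⟨⟨w, z⟩, ⟨hw, hz⟩, rfl⟩
    exact (convex_convexHull ℝ K).sum_mem (fun i _ => hw.1 i) hw.2
      fun i _ => subset_convexHull ℝ K (hz i (Set.mem_univ i))

/-- The bipolar theorem for a cone generated by a compact family lying in an affine hyperplane
off the origin: the cone is already closed. -/
theorem mem_hull_range_of_forall_dual {V X : Type*} [AddCommGroup V] [Module ℝ V]
    [FiniteDimensional ℝ V] [TopologicalSpace X] [CompactSpace X] {k : X → V}
    (hk : ∀ φ : Dual ℝ V, Continuous fun x => φ (k x)) {u : Dual ℝ V} (hu : ∀ x, u (k x) = 1)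
    {v : V} (hv : ∀ φ : Dual ℝ V, (∀ x, 0 ≤ φ (k x)) → 0 ≤ φ v) :
    v ∈ PointedCone.hull ℝ (Set.range k) := by
  have huv : 0 ≤ u v := hv u fun x => by rw [hu]; exact zero_le_one
  rcases huv.eq_or_lt with h0 | h0
  · suffices v = 0 by rw [this]; exact zero_mem _
    rw [← forall_dual_apply_eq_zero_iff ℝ]
    have key : ∀ φ : Dual ℝ V, 0 ≤ φ v := by
      intro φ
      obtain ⟨c, hc⟩ := (isCompact_range (hk φ)).bddBelow
      -- Subtracting a lower bound `c` times `u` makes any `φ` nonnegative on the family without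
      -- changing its value at `v`, since `u v = 0`.
      have h := hv (φ - c • u) fun x => by
        simpa [hu] using hc ⟨x, rfl⟩
      simpa [← h0] using h
    intro φ
    have h := key (-φ)
    exact le_antisymm (by simpa using h) (key φ)
  · let b := finBasis ℝ V
    let e := b.equivFun
    have hcont : Continuous fun x => e (k x) := continuous_pi fun i => hk (b.coord i)
    have hcomp : IsCompact (convexHull ℝ (Set.range fun x => e (k x))) :=
      isCompact_convexHull_of_finiteDimensional (isCompact_range hcont)
    have hmem : e ((u v)⁻¹ • v) ∈ convexHull ℝ (Set.range fun x => e (k x)) := by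
      by_contra hnot
      obtain ⟨f, c, hf, hfc⟩ := geometric_hahn_banach_point_closed (convex_convexHull ℝ _)
        hcomp.isClosed hnot
      -- As `u = 1` on the family, the affine separation `f > c` becomes the linear inequality `f -
      -- c • u ≥ 0`.
      have h := hv ((f : (Fin (finrank ℝ V) → ℝ) →ₗ[ℝ] ℝ) ∘ₗ e.toLinearMap - c • u) fun x => by
        have := hfc _ (subset_convexHull ℝ _ ⟨x, rfl⟩)
        simpa [hu] using this.le
      have h2 : f (e v) < c * u v := by
        simp only [map_smul, smul_eq_mul] at hf
        rwa [inv_mul_lt_iff₀ h0, mul_comm] at hf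
      simp at h
      linarith
    have hsub : convexHull ℝ (Set.range fun x => e (k x)) ⊆
        e.symm ⁻¹' (PointedCone.hull ℝ (Set.range k) : Set V) := by
      refine convexHull_min ?_ ((PointedCone.convex _).linear_preimage e.symm.toLinearMap)
      rintro _ ⟨x, rfl⟩
      simpa using PointedCone.subset_hull (R := ℝ) (s := Set.range k) ⟨x, rfl⟩
    have h := hsub hmem
    simp only [Set.mem_preimage, LinearEquiv.symm_apply_apply, SetLike.mem_coe] at h
    have := PointedCone.smul_mem _ h0.le h
    rwa [smul_smul, mul_inv_cancel₀ h0.ne', one_smul] at this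

/-! ### Contractions as mixtures of orthogonal matrices. -/

open Matrix in
/-- A real square matrix of operator norm at most one is a convex combination of orthogonal
matrices. -/
theorem mem_convexHull_orthogonal {n : Type*} [Fintype n] [DecidableEq n] {M : Matrix n n ℝ}
    (hM : ∀ v : n → ℝ, (M *ᵥ v) ⬝ᵥ (M *ᵥ v) ≤ v ⬝ᵥ v) :
    M ∈ convexHull ℝ {O : Matrix n n ℝ | Oᵀ * O = 1} := by
  have hA : (Mᵀ * M).IsHermitian := by
    simpa using Matrix.isHermitian_conjTranspose_mul_self M
  let e := hA.eigenvectorBasis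
  let l := hA.eigenvalues
  have hee : ∀ i j, (e i).ofLp ⬝ᵥ (e j).ofLp = if i = j then 1 else 0 := by
    intro i j
    have h := (orthonormal_iff_ite.mp e.orthonormal) j i
    simp only [EuclideanSpace.inner_eq_star_dotProduct, star_trivial] at h
    simpa [eq_comm] using h
  have hMe : ∀ i j, (M *ᵥ (e i).ofLp) ⬝ᵥ (M *ᵥ (e j).ofLp) = if i = j then l i else 0 := by
    intro i j
    have h := hA.mulVec_eigenvectorBasis j
    rw [← mulVec_mulVec] at h
    have : (M *ᵥ (e i).ofLp) ⬝ᵥ (M *ᵥ (e j).ofLp)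
        = (e i).ofLp ⬝ᵥ (Mᵀ *ᵥ (M *ᵥ (e j).ofLp)) := by
      rw [dotProduct_mulVec (e i).ofLp, vecMul_transpose]
    rw [this, h, dotProduct_smul, hee]
    split_ifs with hij
    · subst hij; simp [l]
    · simp
  have hl0 : ∀ i, 0 ≤ l i := fun i => by
    have h := hMe i i
    rw [if_pos rfl] at h
    rw [← h]
    exact Finset.sum_nonneg fun _ _ => mul_self_nonneg _
  have hl1 : ∀ i, l i ≤ 1 := fun i => by
    have h := hM (e i).ofLp
    rwa [hMe, hee, if_pos rfl, if_pos rfl] at h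
  -- Singular value decomposition: the normalized images of the eigenvectors of `Mᵀ * M` outside the
  -- kernel are orthonormal, and completing them to a basis gives the left singular vectors.
  have hon : Orthonormal ℝ (({i | l i ≠ 0} : Set n).domRestrict
      fun i => WithLp.toLp 2 ((√(l i))⁻¹ • (M *ᵥ (e i).ofLp))) := by
    rw [orthonormal_iff_ite]
    rintro ⟨i, hi⟩ ⟨j, hj⟩
    simp only [Set.domRestrict_apply, EuclideanSpace.inner_eq_star_dotProduct, star_trivial,
      smul_dotProduct, dotProduct_smul, hMe, smul_eq_mul, Subtype.mk.injEq]
    by_cases hij : i = j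
    · subst hij
      have hs : √(l i) ≠ 0 := (Real.sqrt_pos.mpr ((hl0 i).lt_of_ne' hi)).ne'
      simp only [if_true]
      field_simp
      exact (Real.sq_sqrt (hl0 i)).symm
    · simp [hij, Ne.symm hij]
  obtain ⟨f, hf⟩ := hon.exists_orthonormalBasis_extension_of_card_eq (by simp)
  have hMf : ∀ i, M *ᵥ (e i).ofLp = √(l i) • (f i).ofLp := by
    intro i
    by_cases hi : l i = 0
    · have h := hMe i i
      rw [if_pos rfl, hi, dotProduct_self_eq_zero] at h
      simp [h, hi]
    · have hs : √(l i) ≠ 0 := (Real.sqrt_pos.mpr ((hl0 i).lt_of_ne' hi)).ne'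
      rw [hf i hi, smul_smul, mul_inv_cancel₀ hs, one_smul]
  have hff : ∀ i j, (f i).ofLp ⬝ᵥ (f j).ofLp = if i = j then 1 else 0 := by
    intro i j
    have h := (orthonormal_iff_ite.mp f.orthonormal) j i
    simp only [EuclideanSpace.inner_eq_star_dotProduct, star_trivial] at h
    simpa [eq_comm] using h
  let U : Matrix n n ℝ := of fun i j => (f j).ofLp i
  let W : Matrix n n ℝ := of fun i j => (e i).ofLp j
  have hU : Uᵀ * U = 1 := by
    ext i j
    simpa [U, Matrix.mul_apply, dotProduct, Matrix.one_apply] using hff i j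
  have hW : W * Wᵀ = 1 := by
    ext i j
    simpa [W, Matrix.mul_apply, dotProduct, Matrix.one_apply] using hee i j
  have hW' : Wᵀ * W = 1 := mul_eq_one_comm.mp hW
  have hMW : M * Wᵀ = U * diagonal fun i => √(l i) := by
    ext i j
    have h := congrFun (hMf j) i
    simp only [Pi.smul_apply, smul_eq_mul] at h
    rw [mul_diagonal]
    simpa [U, W, Matrix.mul_apply, mulVec, dotProduct, mul_comm] using h
  have hfac : M = U * diagonal (fun i => √(l i)) * W := by
    rw [← hMW, Matrix.mul_assoc, hW', Matrix.mul_one]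
  let F : (n → ℝ) →ₗ[ℝ] Matrix n n ℝ :=
    { toFun := fun c => U * diagonal c * W
      map_add' := fun c d => by
        rw [← Matrix.add_mul, ← Matrix.mul_add, diagonal_add]; rfl
      map_smul' := fun r c => by
        simp }
  -- The singular values lie in the cube `[-1, 1]ⁿ`, the hull of the sign vectors; a sign vector in
  -- the middle of the decomposition gives an orthogonal matrix.
  have hcube : (fun i => √(l i)) ∈ convexHull ℝ (Set.univ.pi fun _ : n => ({-1, 1} : Set ℝ)) := by
    rw [convexHull_pi]
    intro i _
    rw [convexHull_pair, segment_eq_Icc (by norm_num)]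
    exact ⟨by linarith [Real.sqrt_nonneg (l i)], Real.sqrt_le_one.mpr (hl1 i)⟩
  have hmem : F (fun i => √(l i)) ∈ F '' convexHull ℝ (Set.univ.pi fun _ => ({-1, 1} : Set ℝ)) :=
    ⟨_, hcube, rfl⟩
  rw [LinearMap.image_convexHull] at hmem
  rw [hfac]
  refine convexHull_mono ?_ hmem
  rintro _ ⟨c, hc, rfl⟩
  have hcc : diagonal c * diagonal c = (1 : Matrix n n ℝ) := by
    rw [diagonal_mul_diagonal, ← diagonal_one]
    congr 1
    ext i
    rcases hc i (Set.mem_univ i) with h | h <;> · simp [Set.mem_singleton_iff.mp h]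
  change (U * diagonal c * W)ᵀ * (U * diagonal c * W) = 1
  rw [transpose_mul, transpose_mul, diagonal_transpose]
  calc Wᵀ * (diagonal c * Uᵀ) * (U * diagonal c * W)
      = Wᵀ * (diagonal c * (Uᵀ * U) * diagonal c) * W := by simp only [Matrix.mul_assoc]
    _ = 1 := by rw [hU, Matrix.mul_one, hcc, Matrix.mul_one, hW']

/-! ### Minkowski space and the Lorentz cone. -/

open Matrix

/-- Index set of the coordinates of four-dimensional Minkowski space: one time coordinate and
three space coordinates. -/
abbrev MinkowskiIndex : Type := Unit ⊕ Fin 3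

/-- Four-dimensional Minkowski space. -/
abbrev Minkowski : Type := MinkowskiIndex → ℝ

/-- Real `4 × 4` matrices, regarded as linear maps on Minkowski space. -/
abbrev MinkowskiMatrix : Type := Matrix MinkowskiIndex MinkowskiIndex ℝ

/-- The Minkowski metric as a matrix. -/
def minkowskiMetric : MinkowskiMatrix := fromBlocks 1 0 0 (-1)

/-- The Minkowski form `x₀ y₀ - x₁ y₁ - x₂ y₂ - x₃ y₃`. -/
noncomputable def mink : LinearMap.BilinForm ℝ Minkowski := Matrix.toBilin' minkowskiMetric

theorem mink_eq_dotProduct (x y : Minkowski) : mink x y = x ⬝ᵥ minkowskiMetric *ᵥ y :=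
  Matrix.toBilin'_apply' _ _ _

theorem mink_apply (x y : Minkowski) :
    mink x y = x (.inl ()) * y (.inl ()) - ∑ i, x (.inr i) * y (.inr i) := by
  rw [mink_eq_dotProduct, minkowskiMetric, fromBlocks_mulVec]
  simp [dotProduct, sub_eq_add_neg, neg_mulVec]

theorem mink_comm (x y : Minkowski) : mink x y = mink y x := by
  simp only [mink_apply, mul_comm]

theorem mink_add_self (x y : Minkowski) :
    mink (x + y) (x + y) = mink x x + 2 * mink x y + mink y y := by
  simp only [map_add, LinearMap.add_apply, mink_comm y x]; ring

theorem minkowskiMetric_mul_self : minkowskiMetric * minkowskiMetric = 1 := by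
  simp [minkowskiMetric, fromBlocks_multiply, fromBlocks_one]

theorem mink_nondegenerate {x : Minkowski} (h : ∀ y, mink x y = 0) : x = 0 := by
  have h' := h (minkowskiMetric *ᵥ x)
  rwa [mink_eq_dotProduct, mulVec_mulVec, minkowskiMetric_mul_self, one_mulVec,
    dotProduct_self_eq_zero] at h'

theorem mink_ext {x y : Minkowski} (h : ∀ z, mink x z = mink y z) : x = y :=
  sub_eq_zero.mp <| mink_nondegenerate fun z => by simp [h z]

/-- The unit vector in the time direction. -/
def timeUnit : Minkowski := Sum.elim 1 0

theorem mink_timeUnit (x : Minkowski) : mink timeUnit x = x (.inl ()) := by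
  simp [mink_apply, timeUnit]

theorem mink_timeUnit_self : mink timeUnit timeUnit = 1 := by
  rw [mink_timeUnit]; rfl

/-- Cauchy–Schwarz for the spatial parts. -/
theorem sum_mul_le_of_timelike {x y : Minkowski} (hx0 : 0 ≤ x (.inl ())) (hx : 0 ≤ mink x x)
    (hy0 : 0 ≤ y (.inl ())) (hy : 0 ≤ mink y y) : 0 ≤ mink x y := by
  rw [mink_apply] at *
  have hcs := Finset.sum_mul_sq_le_sq_mul_sq Finset.univ
    (fun i : Fin 3 => x (.inr i)) (fun i => y (.inr i))
  simp only [← pow_two] at hx hy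
  have h : (∑ i, x (.inr i) * y (.inr i)) ^ 2 ≤ (x (.inl ()) * y (.inl ())) ^ 2 := by
    rw [mul_pow]
    refine hcs.trans (mul_le_mul (by linarith) (by linarith) ?_ (by positivity))
    exact Finset.sum_nonneg fun _ _ => sq_nonneg _
  linarith [abs_le.mp (abs_le_of_sq_le_sq h (mul_nonneg hx0 hy0))]

/-- The (closed, future) Lorentz cone. -/
def lorentzCone : PointedCone ℝ Minkowski where
  carrier := {x | 0 ≤ x (.inl ()) ∧ 0 ≤ mink x x}
  zero_mem' := by simp
  add_mem' := by
    rintro x y ⟨hx0, hx⟩ ⟨hy0, hy⟩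
    refine ⟨add_nonneg hx0 hy0, ?_⟩
    rw [mink_add_self]
    linarith [sum_mul_le_of_timelike hx0 hx hy0 hy]
  smul_mem' := by
    rintro ⟨c, hc⟩ x ⟨hx0, hx⟩
    refine ⟨mul_nonneg hc hx0, ?_⟩
    change 0 ≤ mink (c • x) (c • x)
    simp only [map_smul, LinearMap.smul_apply, smul_eq_mul]
    positivity

theorem mem_lorentzCone {x : Minkowski} :
    x ∈ lorentzCone ↔ 0 ≤ x (.inl ()) ∧ 0 ≤ mink x x := Iff.rfl

theorem mink_nonneg {x y : Minkowski} (hx : x ∈ lorentzCone) (hy : y ∈ lorentzCone) :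
    0 ≤ mink x y := sum_mul_le_of_timelike hx.1 hx.2 hy.1 hy.2

theorem timeUnit_mem : timeUnit ∈ lorentzCone :=
  ⟨zero_le_one, by rw [mink_timeUnit_self]; exact zero_le_one⟩

theorem eq_zero_of_time_eq_zero {x : Minkowski} (hx : x ∈ lorentzCone)
    (h : x (.inl ()) = 0) : x = 0 := by
  have h2 := hx.2
  rw [mink_apply, h] at h2
  have h3 : ∑ i, x (.inr i) * x (.inr i) = 0 :=
    le_antisymm (by linarith) (Finset.sum_nonneg fun _ _ => mul_self_nonneg _)
  rw [Finset.sum_eq_zero_iff_of_nonneg fun _ _ => mul_self_nonneg _] at h3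
  ext (i | i)
  · exact h
  · simpa using h3 i (Finset.mem_univ i)

theorem time_pos {x : Minkowski} (hx : x ∈ lorentzCone) (h : x ≠ 0) : 0 < x (.inl ()) :=
  hx.1.lt_of_ne' fun h' => h (eq_zero_of_time_eq_zero hx h')

/-- The Lorentz cone is self-dual with respect to the Minkowski form. -/
theorem mem_lorentzCone_of_forall {x : Minkowski} (h : ∀ y ∈ lorentzCone, 0 ≤ mink x y) :
    x ∈ lorentzCone := by
  have h0 : 0 ≤ x (.inl ()) := by
    have := h _ timeUnit_mem
    rwa [mink_comm, mink_timeUnit] at this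
  refine ⟨h0, ?_⟩
  set s := ∑ i, x (.inr i) * x (.inr i) with hs
  have hs0 : 0 ≤ s := Finset.sum_nonneg fun _ _ => mul_self_nonneg _
  have hr := Real.sqrt_nonneg s
  have hrr := Real.mul_self_sqrt hs0
  -- The test vector is the null vector with the spatial part of `x`; pairing with it gives `√s *
  -- (x₀ - √s) ≥ 0`.
  have h1 := h (Sum.elim (fun _ => √s) fun i => x (.inr i)) ⟨hr, by
    rw [mink_apply]; simp only [Sum.elim_inl, Sum.elim_inr]; rw [hrr, ← hs, sub_self]⟩
  rw [mink_apply] at h1 ⊢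
  simp only [Sum.elim_inl, Sum.elim_inr] at h1
  rw [← hs] at h1 ⊢
  rcases hr.eq_or_lt with h2 | h2
  · rw [← h2] at hrr; nlinarith
  · have : √s ≤ x (.inl ()) := by
      by_contra hlt
      push Not at hlt
      nlinarith
    nlinarith

/-- This is the equality case of Cauchy–Schwarz: the squared length of the spatial difference is at
most zero. -/
theorem smul_eq_smul_of_mink_eq_zero {x y : Minkowski} (hx : x ∈ lorentzCone)
    (hy : y ∈ lorentzCone) (h : mink x y = 0) : y (.inl ()) • x = x (.inl ()) • y := by
  have hxx := hx.2
  have hyy := hy.2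
  rw [mink_apply] at hxx hyy h
  have key : ∑ i : Fin 3, (y (.inl ()) * x (.inr i) - x (.inl ()) * y (.inr i)) ^ 2 = 0 := by
    refine le_antisymm ?_ (Finset.sum_nonneg fun _ _ => sq_nonneg _)
    have : ∑ i : Fin 3, (y (.inl ()) * x (.inr i) - x (.inl ()) * y (.inr i)) ^ 2
        = y (.inl ()) ^ 2 * ∑ i, x (.inr i) * x (.inr i)
          + x (.inl ()) ^ 2 * ∑ i, y (.inr i) * y (.inr i)
          - 2 * x (.inl ()) * y (.inl ()) * ∑ i, x (.inr i) * y (.inr i) := by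
      simp only [Finset.mul_sum, ← Finset.sum_add_distrib, ← Finset.sum_sub_distrib]
      exact Finset.sum_congr rfl fun _ _ => by ring
    rw [this]
    have h' : ∑ i, x (.inr i) * y (.inr i) = x (.inl ()) * y (.inl ()) := by linarith
    rw [h']
    nlinarith [mul_nonneg (sq_nonneg (x (.inl ()))) hyy, mul_nonneg (sq_nonneg (y (.inl ()))) hxx]
  rw [Finset.sum_eq_zero_iff_of_nonneg fun _ _ => sq_nonneg _] at key
  ext (i | i)
  · exact mul_comm _ _
  · have := pow_eq_zero_iff (two_ne_zero) |>.mp (key i (Finset.mem_univ i))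
    simp only [Pi.smul_apply, smul_eq_mul]
    linarith

/-- Elements of the Lorentz cone that are orthogonal to each other are proportional. -/
theorem eq_smul_of_mink_eq_zero {x y : Minkowski} (hx : x ∈ lorentzCone) (hx0 : x ≠ 0)
    (hy : y ∈ lorentzCone) (h : mink x y = 0) : y = (y (.inl ()) / x (.inl ())) • x := by
  have hp := time_pos hx hx0
  have := smul_eq_smul_of_mink_eq_zero hx hy h
  rw [div_eq_inv_mul, ← smul_smul, this, smul_smul, inv_mul_cancel₀ hp.ne', one_smul]

theorem mink_pos {x y : Minkowski} (hx : x ∈ lorentzCone) (hx0 : x ≠ 0)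
    (hy : y ∈ lorentzCone) (hyy : 0 < mink y y) : 0 < mink x y := by
  refine (mink_nonneg hx hy).lt_of_ne' fun h => ?_
  have hy' := eq_smul_of_mink_eq_zero hx hx0 hy h
  rw [hy'] at hyy
  rw [hy'] at h
  simp only [map_smul, LinearMap.smul_apply, smul_eq_mul] at hyy h
  rw [h, mul_zero] at hyy
  exact hyy.false

/-- Null vectors generate extreme rays of the Lorentz cone. -/
theorem eq_smul_of_sub_mem {x y : Minkowski} (hx : x ∈ lorentzCone) (hx0 : x ≠ 0)
    (hxx : mink x x = 0) (hy : y ∈ lorentzCone) (hxy : x - y ∈ lorentzCone) :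
    y = (y (.inl ()) / x (.inl ())) • x := by
  refine eq_smul_of_mink_eq_zero hx hx0 hy (le_antisymm ?_ (mink_nonneg hx hy))
  have := mink_nonneg hx hxy
  rw [map_sub, hxx] at this
  linarith

/-! ### Adjoints, positive maps and conformal maps. -/

/-- The adjoint of a matrix with respect to the Minkowski form. -/
def minkAdjoint (T : MinkowskiMatrix) : MinkowskiMatrix := minkowskiMetric * Tᵀ * minkowskiMetric

theorem mink_minkAdjoint (T : MinkowskiMatrix) (x y : Minkowski) :
    mink (minkAdjoint T *ᵥ x) y = mink x (T *ᵥ y) := by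
  rw [mink_comm, mink_comm x, mink_eq_dotProduct, mink_eq_dotProduct, mulVec_mulVec, minkAdjoint,
    ← Matrix.mul_assoc, ← Matrix.mul_assoc, minkowskiMetric_mul_self, Matrix.one_mul,
    ← mulVec_mulVec, dotProduct_mulVec, vecMul_transpose]

theorem mink_minkAdjoint' (T : MinkowskiMatrix) (x y : Minkowski) :
    mink x (minkAdjoint T *ᵥ y) = mink (T *ᵥ x) y := by
  rw [mink_comm, mink_minkAdjoint, mink_comm]

/-- The rank one map `x ↦ ⟨w, x⟩ z`. -/
noncomputable def ketBra (z w : Minkowski) : MinkowskiMatrix := vecMulVec z (minkowskiMetric *ᵥ w)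

theorem ketBra_mulVec (z w x : Minkowski) : ketBra z w *ᵥ x = mink w x • z := by
  rw [ketBra, vecMulVec_mulVec, mink_comm, mink_eq_dotProduct, dotProduct_comm]
  ext i
  simp [mul_comm]

theorem ketBra_add (z w w' : Minkowski) : ketBra z (w + w') = ketBra z w + ketBra z w' := by
  simp [ketBra, mulVec_add, vecMulVec_add]

theorem matrix_ext {S T : MinkowskiMatrix} (h : ∀ x, S *ᵥ x = T *ᵥ x) : S = T :=
  Matrix.mulVec_injective (funext h)

/-- The cone of linear maps preserving the Lorentz cone. -/
def positiveMaps : PointedCone ℝ MinkowskiMatrix where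
  carrier := {T | ∀ x ∈ lorentzCone, T *ᵥ x ∈ lorentzCone}
  zero_mem' := fun x _ => by simp
  add_mem' := fun hS hT x hx => by rw [add_mulVec]; exact add_mem (hS x hx) (hT x hx)
  smul_mem' := fun c T hT x hx => by
    change ((c : ℝ) • T) *ᵥ x ∈ _
    rw [smul_mulVec]; exact PointedCone.smul_mem _ c.2 (hT x hx)

/-- Self-duality of the Lorentz cone carries positivity over to the adjoint. -/
theorem minkAdjoint_mem {T : MinkowskiMatrix} (hT : T ∈ positiveMaps) :
    minkAdjoint T ∈ positiveMaps := fun x hx => mem_lorentzCone_of_forall fun y hy => by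
  rw [mink_minkAdjoint]; exact mink_nonneg hx (hT y hy)

theorem ketBra_mem {z w : Minkowski} (hz : z ∈ lorentzCone) (hw : w ∈ lorentzCone) :
    ketBra z w ∈ positiveMaps := fun x hx => by
  rw [ketBra_mulVec]; exact PointedCone.smul_mem _ (mink_nonneg hw hx) hz

/-- `T` multiplies the Minkowski form by `c`. -/
def IsConformal (c : ℝ) (T : MinkowskiMatrix) : Prop :=
  ∀ x y, mink (T *ᵥ x) (T *ᵥ y) = c * mink x y

theorem IsConformal.mul {c d : ℝ} {S T : MinkowskiMatrix} (hS : IsConformal c S)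
    (hT : IsConformal d T) : IsConformal (c * d) (S * T) := fun x y => by
  rw [← mulVec_mulVec, ← mulVec_mulVec, hS, hT, mul_assoc]

theorem IsConformal.smul {c : ℝ} {T : MinkowskiMatrix} (hT : IsConformal c T) (r : ℝ) :
    IsConformal (r ^ 2 * c) (r • T) := fun x y => by
  simp only [smul_mulVec, map_smul, LinearMap.smul_apply, hT x y, smul_eq_mul]
  ring

theorem IsConformal.minkAdjoint_mul {c : ℝ} {T : MinkowskiMatrix} (hT : IsConformal c T) :
    minkAdjoint T * T = c • 1 := by
  refine matrix_ext fun x => mink_ext fun y => ?_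
  rw [← mulVec_mulVec, mink_minkAdjoint, hT, smul_mulVec, one_mulVec, map_smul,
    LinearMap.smul_apply, smul_eq_mul]

theorem IsConformal.mul_minkAdjoint {c : ℝ} {T : MinkowskiMatrix} (hT : IsConformal c T)
    (hc : c ≠ 0) : T * minkAdjoint T = c • 1 := by
  have h : (c⁻¹ • minkAdjoint T) * T = 1 := by
    rw [smul_mul, hT.minkAdjoint_mul, smul_smul, inv_mul_cancel₀ hc, one_smul]
  have h' := mul_eq_one_comm.mp h
  rw [Matrix.mul_smul] at h'
  rw [← h', smul_smul, mul_inv_cancel₀ hc, one_smul]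

theorem IsConformal.minkAdjoint {c : ℝ} {T : MinkowskiMatrix} (hT : IsConformal c T)
    (hc : c ≠ 0) : IsConformal c (minkAdjoint T) := fun x y => by
  rw [mink_minkAdjoint, mulVec_mulVec, hT.mul_minkAdjoint hc, smul_mulVec, one_mulVec, map_smul,
    smul_eq_mul]

/-- The isometries of Minkowski space that preserve the Lorentz cone. -/
def orthochronous : Set MinkowskiMatrix := {T | T ∈ positiveMaps ∧ IsConformal 1 T}

theorem orthochronous_mul {S T : MinkowskiMatrix} (hS : S ∈ orthochronous)
    (hT : T ∈ orthochronous) : S * T ∈ orthochronous := by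
  refine ⟨fun x hx => ?_, by simpa using hS.2.mul hT.2⟩
  rw [← mulVec_mulVec]
  exact hS.1 _ (hT.1 x hx)

theorem mul_mul_mem_hull {g h T : MinkowskiMatrix} (hg : g ∈ orthochronous)
    (hh : h ∈ orthochronous) (hT : T ∈ PointedCone.hull ℝ orthochronous) :
    g * T * h ∈ PointedCone.hull ℝ orthochronous := by
  induction hT using Submodule.span_induction with
  | mem x hx => exact Submodule.subset_span (orthochronous_mul (orthochronous_mul hg hx) hh)
  | zero => simp
  | add x y _ _ hx hy => rw [Matrix.mul_add, Matrix.add_mul]; exact add_mem hx hy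
  | smul c x _ hx =>
    have : g * (c • x) * h = c • (g * x * h) := by
      rw [Matrix.mul_smul, Matrix.smul_mul]
    rw [this]
    exact Submodule.smul_mem _ _ hx

/-! ### Half-turns and transitivity on the hyperboloid. -/

/-- The half-turn about the axis spanned by a timelike vector `m`. -/
noncomputable def halfTurn (m : Minkowski) : MinkowskiMatrix :=
  (2 / mink m m) • ketBra m m - 1

theorem halfTurn_mulVec (m x : Minkowski) :
    halfTurn m *ᵥ x = (2 / mink m m * mink m x) • m - x := by
  rw [halfTurn, sub_mulVec, smul_mulVec, ketBra_mulVec, one_mulVec, smul_smul]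

theorem mink_halfTurn_left (m x y : Minkowski) :
    mink (halfTurn m *ᵥ x) y = mink x (halfTurn m *ᵥ y) := by
  simp only [halfTurn_mulVec, map_sub, map_smul, LinearMap.sub_apply, LinearMap.smul_apply,
    smul_eq_mul, mink_comm x m]
  ring

theorem halfTurn_halfTurn {m : Minkowski} (hm : mink m m ≠ 0) (x : Minkowski) :
    halfTurn m *ᵥ (halfTurn m *ᵥ x) = x := by
  simp only [halfTurn_mulVec, map_sub, map_smul, smul_eq_mul]
  have : 2 / mink m m * (2 / mink m m * mink m x * mink m m - mink m x)
      = 2 / mink m m * mink m x := by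
    field_simp
    ring
  rw [this, sub_sub_cancel]

theorem isConformal_halfTurn {m : Minkowski} (hm : mink m m ≠ 0) :
    IsConformal 1 (halfTurn m) := fun x y => by
  rw [mink_halfTurn_left, halfTurn_halfTurn hm, one_mul]

theorem halfTurn_mem {m : Minkowski} (hm : 0 < mink m m) : halfTurn m ∈ orthochronous := by
  have hc := isConformal_halfTurn hm.ne'
  refine ⟨?_, hc⟩
  -- This case suffices: the half-turn is self-adjoint, so the time coordinate of the image of `x`
  -- is the pairing of `x` with the image of `timeUnit`.
  have key : halfTurn m *ᵥ timeUnit ∈ lorentzCone := by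
    refine ⟨?_, by rw [hc, mink_timeUnit_self]; norm_num⟩
    rw [← mink_timeUnit (halfTurn m *ᵥ timeUnit), halfTurn_mulVec, map_sub, map_smul, mink_timeUnit_self,
      mink_comm m timeUnit, mink_timeUnit, smul_eq_mul, sub_nonneg, mul_assoc, div_mul_eq_mul_div, one_le_div hm]
    have : mink m m ≤ m (.inl ()) * m (.inl ()) := by
      rw [mink_apply]
      linarith [Finset.sum_nonneg fun (i : Fin 3) (_ : i ∈ Finset.univ) =>
        mul_self_nonneg (m (.inr i))]
    nlinarith [mul_self_nonneg (m (.inl ()))]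
  intro x hx
  refine ⟨?_, by rw [hc, one_mul]; exact hx.2⟩
  rw [← mink_timeUnit (halfTurn m *ᵥ x), ← mink_halfTurn_left]
  exact mink_nonneg key hx

/-- The orthochronous group acts transitively on the unit hyperboloid. -/
theorem exists_orthochronous_swap {x : Minkowski} (hx : x ∈ lorentzCone) (hxx : mink x x = 1) :
    ∃ h ∈ orthochronous, h *ᵥ timeUnit = x ∧ (∀ y, h *ᵥ (h *ᵥ y) = y) ∧
      ∀ y z, mink (h *ᵥ y) z = mink y (h *ᵥ z) := by
  -- Two unit vectors are exchanged by the half-turn about their sum.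
  have hm : mink (timeUnit + x) (timeUnit + x) = 2 * mink (timeUnit + x) timeUnit := by
    rw [mink_add_self, map_add, LinearMap.add_apply, mink_timeUnit_self, hxx, mink_comm x]
    ring
  have hpos : 0 < mink (timeUnit + x) (timeUnit + x) := by
    rw [mink_add_self, mink_timeUnit_self, hxx]
    linarith [mink_nonneg timeUnit_mem hx]
  refine ⟨halfTurn (timeUnit + x), halfTurn_mem hpos, ?_, halfTurn_halfTurn hpos.ne',
    mink_halfTurn_left _⟩
  rw [halfTurn_mulVec, div_mul_eq_mul_div, ← hm, div_self hpos.ne', one_smul,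
    add_sub_cancel_left]

/-! ### Maps fixing the time axis. -/

theorem fromBlocks_mulVec_eq (O : Matrix (Fin 3) (Fin 3) ℝ) (x : Minkowski) :
    (fromBlocks 1 0 0 O : MinkowskiMatrix) *ᵥ x
      = Sum.elim (fun _ => x (.inl ())) (O *ᵥ (x ∘ Sum.inr)) := by
  rw [fromBlocks_mulVec]
  ext (i | i)
  · simp
  · simp

theorem mink_elim (s t : ℝ) (v w : Fin 3 → ℝ) :
    mink (Sum.elim (fun _ => s) v) (Sum.elim (fun _ => t) w) = s * t - v ⬝ᵥ w := by
  rw [mink_apply]; rfl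

theorem fromBlocks_mem_orthochronous {O : Matrix (Fin 3) (Fin 3) ℝ} (hO : Oᵀ * O = 1) :
    (fromBlocks 1 0 0 O : MinkowskiMatrix) ∈ orthochronous := by
  have hc : IsConformal 1 (fromBlocks 1 0 0 O : MinkowskiMatrix) := fun x y => by
    rw [fromBlocks_mulVec_eq, fromBlocks_mulVec_eq, mink_elim, dotProduct_mulVec,
      vecMul_mulVec, ← mulVec_transpose, transpose_mul, transpose_transpose, hO, one_mulVec,
      mink_apply, one_mul]
    rfl
  refine ⟨fun x hx => ⟨?_, by rw [hc, one_mul]; exact hx.2⟩, hc⟩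
  rw [fromBlocks_mulVec_eq]
  exact hx.1

/-- Both conditions on `timeUnit` force the block form `1 ⊕ M`. Applying `T` to null vectors shows
that `M` is a contraction, hence a mixture of orthogonal matrices. -/
theorem mem_hull_of_fixes_timeUnit {T : MinkowskiMatrix} (hT : T ∈ positiveMaps)
    (hu : T *ᵥ timeUnit = timeUnit) (hu' : ∀ x, mink timeUnit (T *ᵥ x) = mink timeUnit x) :
    T ∈ PointedCone.hull ℝ orthochronous := by
  have hb : T = fromBlocks 1 0 0 T.toBlocks₂₂ := by
    have h0 : ∀ i, T i (.inl ()) = timeUnit i := fun i => by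
      have := congrFun hu i
      simpa [mulVec, dotProduct, timeUnit] using this
    have h1 : ∀ j, T (.inl ()) (.inr j) = 0 := fun j => by
      have := hu' (Pi.single (.inr j) 1)
      simpa [mink_timeUnit] using this
    ext (i | i) (j | j)
    · simpa [timeUnit, Matrix.one_apply] using h0 (.inl ())
    · simpa using h1 j
    · simpa [timeUnit] using h0 (.inr i)
    · rfl
  have hM : ∀ v : Fin 3 → ℝ,
      (T.toBlocks₂₂ *ᵥ v) ⬝ᵥ (T.toBlocks₂₂ *ᵥ v) ≤ v ⬝ᵥ v := by
    intro v
    have hv0 : 0 ≤ v ⬝ᵥ v := Finset.sum_nonneg fun _ _ => mul_self_nonneg _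
    have hv : Sum.elim (fun _ => √(v ⬝ᵥ v)) v ∈ lorentzCone :=
      ⟨Real.sqrt_nonneg _, by rw [mink_elim, Real.mul_self_sqrt hv0, sub_self]⟩
    have h := (hT _ hv).2
    rw [hb, fromBlocks_mulVec_eq, mink_elim] at h
    simp only [Sum.elim_inl, Sum.elim_comp_inr, Real.mul_self_sqrt hv0] at h
    linarith
  have hsub : convexHull ℝ {O : Matrix (Fin 3) (Fin 3) ℝ | Oᵀ * O = 1} ⊆
      {O | (fromBlocks 1 0 0 O : MinkowskiMatrix) ∈ PointedCone.hull ℝ orthochronous} := by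
    refine convexHull_min
      (fun O hO => Submodule.subset_span (fromBlocks_mem_orthochronous hO)) ?_
    intro O hO O' hO' a b ha hb hab
    have : (fromBlocks 1 0 0 (a • O + b • O') : MinkowskiMatrix)
        = a • fromBlocks 1 0 0 O + b • fromBlocks 1 0 0 O' := by
      simp [fromBlocks_smul, fromBlocks_add, ← add_smul, hab]
    change (fromBlocks 1 0 0 (a • O + b • O') : MinkowskiMatrix) ∈ PointedCone.hull ℝ _
    rw [this]
    exact add_mem (PointedCone.smul_mem _ ha hO) (PointedCone.smul_mem _ hb hO')
  rw [hb]
  exact hsub (mem_convexHull_orthogonal hM)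

/-! ### Critical directions and decomposition of strictly positive maps. -/

theorem continuous_mink_mulVec (T : MinkowskiMatrix) :
    Continuous fun x => mink (T *ᵥ x) (T *ᵥ x) := by
  simp only [mink_apply, mulVec, dotProduct]
  fun_prop

theorem continuous_mink_self : Continuous fun x => mink x x := by
  simp only [mink_apply]
  fun_prop

theorem abs_le_time {x : Minkowski} (hx : x ∈ lorentzCone) (i : MinkowskiIndex) :
    |x i| ≤ x (.inl ()) := by
  rcases i with i | i
  · exact (abs_of_nonneg hx.1).le
  · refine abs_le_of_sq_le_sq ?_ hx.1
    have h := hx.2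
    rw [mink_apply] at h
    have := Finset.single_le_sum (f := fun i => x (.inr i) * x (.inr i))
      (fun _ _ => mul_self_nonneg _) (Finset.mem_univ i)
    nlinarith

theorem isClosed_lorentzCone : IsClosed (lorentzCone : Set Minkowski) :=
  (isClosed_le continuous_const (continuous_apply _)).inter
    (isClosed_le continuous_const continuous_mink_self)

/-- The normalized elements of the Lorentz cone. -/
def lorentzBase : Set Minkowski := {x | x ∈ lorentzCone ∧ x (.inl ()) = 1}

theorem isCompact_lorentzBase : IsCompact lorentzBase := by
  refine IsCompact.of_isClosed_subset (isCompact_univ_pi fun _ => isCompact_Icc (a := -1) (b := 1))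
    (isClosed_lorentzCone.inter (isClosed_eq (continuous_apply _) continuous_const)) ?_
  intro x hx i _
  have := abs_le_time hx.1 i
  rw [hx.2] at this
  exact abs_le.mp this

theorem inv_time_smul_mem {x : Minkowski} (hx : x ∈ lorentzCone) (hx0 : x ≠ 0) :
    (x (.inl ()))⁻¹ • x ∈ lorentzBase := by
  have hp := time_pos hx hx0
  exact ⟨PointedCone.smul_mem _ (inv_nonneg.mpr hp.le) hx, by simp [hp.ne']⟩

theorem mink_smul_smul (c : ℝ) (x y : Minkowski) :
    mink (c • x) (c • y) = c ^ 2 * mink x y := by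
  simp only [map_smul, LinearMap.smul_apply, smul_eq_mul]; ring

theorem eventually_add_smul_mem {x : Minkowski} (hx : x ∈ lorentzCone) (hxx : 0 < mink x x)
    (v : Minkowski) : ∀ᶠ s : ℝ in 𝓝 0, x + s • v ∈ lorentzCone := by
  have hx0 : 0 < x (.inl ()) := time_pos hx fun h => by simp [h] at hxx
  have h1 : Continuous fun s : ℝ => (x + s • v) (.inl ()) := by
    simp only [Pi.add_apply, Pi.smul_apply]; fun_prop
  have h2 : Continuous fun s : ℝ => mink (x + s • v) (x + s • v) :=
    continuous_mink_self.comp (by fun_prop)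
  have e1 := (h1.tendsto 0).eventually_const_lt (by simpa using hx0)
  have e2 := (h2.tendsto 0).eventually_const_lt (by simpa using hxx)
  filter_upwards [e1, e2] with s hs1 hs2 using ⟨hs1.le, hs2.le⟩

/-- First-order optimality: the expression has a local minimum at `0`, where its derivative is `a`.
-/
theorem eq_zero_of_eventually_nonneg {a b : ℝ} (h : ∀ᶠ s : ℝ in 𝓝 0, 0 ≤ a * s + b * s ^ 2) :
    a = 0 := by
  have hmin : IsLocalMin (fun s : ℝ => a * s + b * s ^ 2) 0 := by
    filter_upwards [h] with s hs
    simpa using hs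
  have hd : HasDerivAt (fun s : ℝ => a * s + b * s ^ 2) (a * 1 + b * ((2 : ℕ) * 0 ^ (2 - 1) * 1)) 0 := by
    exact ((hasDerivAt_id (0 : ℝ)).const_mul a).add
      (((hasDerivAt_id (0 : ℝ)).pow 2).const_mul b)
  simpa using hmin.hasDerivAt_eq_zero hd

/-- A strictly positive map has a timelike direction that it maps conformally. -/
theorem exists_critical_vector {T : MinkowskiMatrix}
    (hpos : ∀ x ∈ lorentzCone, x ≠ 0 → 0 < mink (T *ᵥ x) (T *ᵥ x)) :
    ∃ x ∈ lorentzCone, 0 < mink x x ∧ ∃ μ > 0, ∀ v, μ * mink (T *ᵥ x) (T *ᵥ v) = mink x v := by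
  have hne : ∀ x ∈ lorentzBase, x ≠ 0 := fun x hx h => by simp [h, lorentzBase] at hx
  -- Maximizing `⟨x, x⟩ / ⟨T x, T x⟩` places the maximizer in the open cone: the ratio vanishes on
  -- null vectors and is positive at `timeUnit`.
  obtain ⟨x, hx, hmax⟩ := isCompact_lorentzBase.exists_isMaxOn
    (f := fun x => mink x x / mink (T *ᵥ x) (T *ᵥ x)) ⟨timeUnit, timeUnit_mem, rfl⟩
    (continuous_mink_self.continuousOn.div (continuous_mink_mulVec T).continuousOn
      fun x hx => (hpos x hx.1 (hne x hx)).ne')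
  set μ := mink x x / mink (T *ᵥ x) (T *ᵥ x) with hμ
  have hTx := hpos x hx.1 (hne x hx)
  have hμ0 : 0 < μ := by
    refine lt_of_lt_of_le ?_ (hmax ⟨timeUnit_mem, rfl⟩ : _ ≤ μ)
    have := hpos _ timeUnit_mem (hne _ ⟨timeUnit_mem, rfl⟩)
    simp only [mink_timeUnit_self]
    positivity
  have hxx : mink x x = μ * mink (T *ᵥ x) (T *ᵥ x) := by
    rw [hμ, div_mul_cancel₀ _ hTx.ne']
  have hxpos : 0 < mink x x := by rw [hxx]; positivity
  have hle : ∀ y ∈ lorentzCone, mink y y ≤ μ * mink (T *ᵥ y) (T *ᵥ y) := by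
    intro y hy
    by_cases hy0 : y = 0
    · simp [hy0]
    have hty := time_pos hy hy0
    have h := hmax (inv_time_smul_mem hy hy0)
    simp only [Set.mem_ofPred_eq, mulVec_smul, mink_smul_smul] at h
    rw [mul_div_mul_left _ _ (by positivity), div_le_iff₀ (hpos y hy hy0)] at h
    exact h
  refine ⟨x, hx.1, hxpos, μ, hμ0, fun v => ?_⟩
  -- Expansion of `hle` at `x + s • v`; the constant term vanishes by `hxx`.
  have hev : ∀ᶠ s : ℝ in 𝓝 0, 0 ≤ (2 * (μ * mink (T *ᵥ x) (T *ᵥ v) - mink x v)) * s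
      + (μ * mink (T *ᵥ v) (T *ᵥ v) - mink v v) * s ^ 2 := by
    filter_upwards [eventually_add_smul_mem hx.1 hxpos v] with s hs
    have h := hle _ hs
    rw [mulVec_add, mulVec_smul, mink_add_self, mink_add_self, mink_smul_smul,
      mink_smul_smul, map_smul, map_smul, hxx] at h
    simp only [smul_eq_mul] at h
    linarith
  linarith [eq_zero_of_eventually_nonneg hev]

/-- Strictly positive maps are conic combinations of Lorentz transformations. -/
theorem mem_hull_orthochronous {T : MinkowskiMatrix} (hT : T ∈ positiveMaps)
    (hpos : ∀ x ∈ lorentzCone, x ≠ 0 → 0 < mink (T *ᵥ x) (T *ᵥ x)) :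
    T ∈ PointedCone.hull ℝ orthochronous := by
  obtain ⟨x, hx, hxx, μ, hμ, hcrit⟩ := exists_critical_vector hpos
  have hs : 0 < √μ := Real.sqrt_pos.mpr hμ
  wlog hx1 : mink x x = 1 generalizing x
  · have hr : 0 < √(mink x x) := Real.sqrt_pos.mpr hxx
    have h1 : mink ((√(mink x x))⁻¹ • x) ((√(mink x x))⁻¹ • x) = 1 := by
      rw [mink_smul_smul, inv_pow, Real.sq_sqrt hxx.le, inv_mul_cancel₀ hxx.ne']
    refine this ((√(mink x x))⁻¹ • x) (PointedCone.smul_mem _ (inv_nonneg.mpr hr.le) hx)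
      (by rw [h1]; exact one_pos) (fun v => ?_) h1
    rw [mulVec_smul, map_smul, map_smul, LinearMap.smul_apply, LinearMap.smul_apply, ← hcrit v]
    simp only [smul_eq_mul]; ring
  have hy : √μ • (T *ᵥ x) ∈ lorentzCone := PointedCone.smul_mem _ hs.le (hT x hx)
  have hyy : mink (√μ • (T *ᵥ x)) (√μ • (T *ᵥ x)) = 1 := by
    rw [mink_smul_smul, Real.sq_sqrt hμ.le, hcrit, hx1]
  obtain ⟨h, hh, hhu, hhh, hhs⟩ := exists_orthochronous_swap hx hx1
  obtain ⟨g, hg, hgu, hgg, hgs⟩ := exists_orthochronous_swap hy hyy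
  -- `h` exchanges `timeUnit` with `x`, and `g` exchanges it with `√μ • T x`. So the product fixes
  -- `timeUnit`, and the critical equation says that its adjoint does too.
  have hS : g * (√μ • T) * h ∈ PointedCone.hull ℝ orthochronous := by
    refine mem_hull_of_fixes_timeUnit (fun z hz => ?_) ?_ fun z => ?_
    · rw [← mulVec_mulVec, ← mulVec_mulVec, smul_mulVec]
      exact hg.1 _ (PointedCone.smul_mem _ hs.le (hT _ (hh.1 z hz)))
    · rw [← mulVec_mulVec, ← mulVec_mulVec, smul_mulVec, hhu, ← hgu, hgg]
    · rw [← mulVec_mulVec, ← mulVec_mulVec, smul_mulVec, ← hgs, hgu, mink_smul_smul,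
        Real.sq_sqrt hμ.le, hcrit, ← hhu, hhs, hhh]
  have h1 := mul_mul_mem_hull hg hh hS
  have h2 : g * (g * (√μ • T) * h) * h = √μ • T := matrix_ext fun z => by
    simp only [← mulVec_mulVec, hhh, hgg]
  rw [h2] at h1
  have h3 := PointedCone.smul_mem _ (inv_nonneg.mpr hs.le) h1
  rwa [smul_smul, inv_mul_cancel₀ hs.ne', one_smul] at h3

/-! ### The compact base of conformal maps. -/

theorem minkAdjoint_minkAdjoint (T : MinkowskiMatrix) : minkAdjoint (minkAdjoint T) = T :=
  matrix_ext fun x => mink_ext fun y => by rw [mink_minkAdjoint, mink_minkAdjoint']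

theorem nonneg_of_mem_hull {V : Type*} [AddCommGroup V] [Module ℝ V] {S : Set V} {φ : Dual ℝ V}
    (h : ∀ x ∈ S, 0 ≤ φ x) {x : V} (hx : x ∈ PointedCone.hull ℝ S) : 0 ≤ φ x := by
  induction hx using Submodule.span_induction with
  | mem x hx => exact h x hx
  | zero => simp
  | add x y _ _ hx hy => rw [map_add]; exact add_nonneg hx hy
  | smul c x _ hx =>
    have : φ (c • x) = (c : ℝ) * φ x := φ.map_smul (c : ℝ) x
    rw [this]
    exact mul_nonneg c.2 hx

/-- The functional `T ↦ ⟨b, T a⟩`. -/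
noncomputable def productFunctional (a b : Minkowski) : Dual ℝ MinkowskiMatrix where
  toFun T := mink b (T *ᵥ a)
  map_add' S T := by rw [add_mulVec, map_add]
  map_smul' c T := by rw [smul_mulVec, map_smul]; rfl

theorem productFunctional_apply (a b : Minkowski) (T : MinkowskiMatrix) :
    productFunctional a b T = mink b (T *ᵥ a) := rfl

/-- Normalized positive maps that are conformal with conformal adjoint (possibly with conformal
factor zero). -/
noncomputable def conformalBase : Set MinkowskiMatrix :=
  {T | T ∈ positiveMaps ∧ mink timeUnit (T *ᵥ timeUnit) = 1 ∧
    minkAdjoint T * T = mink (T *ᵥ timeUnit) (T *ᵥ timeUnit) • 1 ∧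
    T * minkAdjoint T = mink (T *ᵥ timeUnit) (T *ᵥ timeUnit) • 1}

/-- This symmetry transfers steering from one marginal to the other. -/
theorem minkAdjoint_mem_conformalBase {T : MinkowskiMatrix} (hT : T ∈ conformalBase) :
    minkAdjoint T ∈ conformalBase := by
  obtain ⟨hP, h1, h2, h3⟩ := hT
  have hc : mink (minkAdjoint T *ᵥ timeUnit) (minkAdjoint T *ᵥ timeUnit)
      = mink (T *ᵥ timeUnit) (T *ᵥ timeUnit) := by
    rw [mink_minkAdjoint, mulVec_mulVec, h3, smul_mulVec, one_mulVec, map_smul,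
      mink_timeUnit_self, smul_eq_mul, mul_one]
  refine ⟨minkAdjoint_mem hP, ?_, ?_, ?_⟩
  · rw [mink_minkAdjoint', mink_comm, h1]
  · rw [minkAdjoint_minkAdjoint, hc, h3]
  · rw [minkAdjoint_minkAdjoint, hc, h2]

theorem continuous_minkAdjoint : Continuous minkAdjoint := by
  unfold minkAdjoint
  fun_prop

theorem isClosed_positiveMaps : IsClosed (positiveMaps : Set MinkowskiMatrix) := by
  have : (positiveMaps : Set MinkowskiMatrix)
      = ⋂ x ∈ lorentzCone, {T | T *ᵥ x ∈ lorentzCone} := by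
    ext T
    simp only [Set.mem_iInter]
    rfl
  rw [this]
  exact isClosed_biInter fun x _ => isClosed_lorentzCone.preimage (by fun_prop)

theorem isCompact_conformalBase : IsCompact conformalBase := by
  have hu : Continuous fun T : MinkowskiMatrix => T *ᵥ timeUnit := by fun_prop
  have hc : Continuous fun T : MinkowskiMatrix =>
      mink (T *ᵥ timeUnit) (T *ᵥ timeUnit) • (1 : MinkowskiMatrix) :=
    (continuous_mink_self.comp hu).smul continuous_const
  have h0 : Continuous fun T : MinkowskiMatrix => mink timeUnit (T *ᵥ timeUnit) := by
    simp only [mink_timeUnit]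
    exact (continuous_apply (Sum.inl () : MinkowskiIndex)).comp hu
  -- The bound `3`: the images of `timeUnit ± eⱼ` have nonnegative time coordinates with sum `2`, so
  -- the entries of the image of `timeUnit + eⱼ` are at most `2` in absolute value, and those of the
  -- image of `timeUnit` at most `1`.
  refine IsCompact.of_isClosed_subset (isCompact_univ_pi fun _ => isCompact_univ_pi fun _ =>
      isCompact_Icc (a := -3) (b := 3))
    (isClosed_positiveMaps.inter ((isClosed_eq h0 continuous_const).inter
      ((isClosed_eq (continuous_minkAdjoint.matrix_mul continuous_id) hc).inter
      (isClosed_eq (continuous_id.matrix_mul continuous_minkAdjoint) hc)))) ?_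
  rintro T ⟨hP, h1, -⟩ i - j -
  rw [mink_timeUnit] at h1
  have hui := abs_le_time (hP _ timeUnit_mem) i
  rw [h1] at hui
  rcases j with j | j
  · have : (T *ᵥ timeUnit) i = T i (.inl j) := by simp [mulVec, dotProduct, timeUnit]
    rw [this] at hui
    exact abs_le.mp (hui.trans (by norm_num))
  · have hp : ∀ s : ℝ, s * s = 1 →
        timeUnit + s • (Pi.single (.inr j) 1 : Minkowski) ∈ lorentzCone := fun s hs => by
      refine ⟨by simp [timeUnit], ?_⟩
      rw [mink_apply]
      simp [timeUnit, Pi.single_apply, hs]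
    have e1 := abs_le_time (hP _ (hp 1 (by norm_num))) i
    have hm := (hP _ (hp (-1) (by norm_num))).1
    have e0 := (hP _ (hp 1 (by norm_num))).1
    simp only [mulVec_add, mulVec_smul, mulVec_single_one, Pi.add_apply, Pi.smul_apply, h1,
      smul_eq_mul, col_apply, abs_le] at e1 hm e0 hui
    exact ⟨by linarith, by linarith⟩

theorem inv_smul_mem_conformalBase {T : MinkowskiMatrix} (hT : T ∈ orthochronous) :
    0 < mink timeUnit (T *ᵥ timeUnit) ∧
      (mink timeUnit (T *ᵥ timeUnit))⁻¹ • T ∈ conformalBase := by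
  have hpos : 0 < mink timeUnit (T *ᵥ timeUnit) := by
    refine mink_pos timeUnit_mem (fun h => ?_) (hT.1 _ timeUnit_mem) ?_
    · have := mink_timeUnit_self
      simp [h] at this
    · rw [hT.2, mink_timeUnit_self]; norm_num
  refine ⟨hpos, PointedCone.smul_mem _ (inv_nonneg.mpr hpos.le) hT.1, ?_, ?_⟩
  · rw [smul_mulVec, map_smul, smul_eq_mul, inv_mul_cancel₀ hpos.ne']
  · have hc := hT.2.smul (mink timeUnit (T *ᵥ timeUnit))⁻¹
    have hne : (mink timeUnit (T *ᵥ timeUnit))⁻¹ ^ 2 * 1 ≠ 0 := by positivity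
    rw [hc timeUnit timeUnit, mink_timeUnit_self, mul_one]
    exact ⟨hc.minkAdjoint_mul, hc.mul_minkAdjoint hne⟩

/-- Every positive map is a conic combination of conformal ones. -/
theorem positiveMaps_le_hull : positiveMaps ≤ PointedCone.hull ℝ conformalBase := by
  intro T hT
  have : CompactSpace conformalBase := isCompact_iff_compactSpace.mp isCompact_conformalBase
  have h := mem_hull_range_of_forall_dual (k := ((↑) : conformalBase → MinkowskiMatrix))
    (u := productFunctional timeUnit timeUnit) (v := T)
    (fun φ => φ.continuous_of_finiteDimensional.comp continuous_subtype_val)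
    (fun x => x.2.2.1) fun φ hφ => ?_
  · rwa [Subtype.range_coe] at h
  have hS : ∀ S ∈ orthochronous, 0 ≤ φ S := fun S hS => by
    obtain ⟨hpos, hmem⟩ := inv_smul_mem_conformalBase hS
    have := hφ ⟨_, hmem⟩
    rw [map_smul, smul_eq_mul] at this
    exact nonneg_of_mul_nonneg_right this (inv_pos.mpr hpos)
  -- Adding a positive multiple of `ketBra timeUnit timeUnit` pushes the image of every nonzero cone
  -- vector into the open cone; then `ε` tends to `0`.
  have hε : ∀ ε : ℝ, 0 < ε → 0 ≤ φ T + ε * φ (ketBra timeUnit timeUnit) := fun ε hε => by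
    have : T + ε • ketBra timeUnit timeUnit ∈ PointedCone.hull ℝ orthochronous := by
      refine mem_hull_orthochronous (add_mem hT (PointedCone.smul_mem _ hε.le
        (ketBra_mem timeUnit_mem timeUnit_mem))) fun x hx hx0 => ?_
      have hxt := time_pos hx hx0
      rw [add_mulVec, smul_mulVec, ketBra_mulVec, mink_timeUnit, smul_smul, mink_add_self,
        mink_smul_smul, mink_timeUnit_self, map_smul, smul_eq_mul, mink_comm _ timeUnit]
      have h1 := (hT x hx).2
      have h2 := mink_nonneg timeUnit_mem (hT x hx)
      positivity
    have := nonneg_of_mem_hull hS this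
    simpa using this
  have ht : Filter.Tendsto (fun ε : ℝ => φ T + ε * φ (ketBra timeUnit timeUnit)) (𝓝[>] 0)
      (𝓝 (φ T)) := by
    have : Continuous fun ε : ℝ => φ T + ε * φ (ketBra timeUnit timeUnit) := by fun_prop
    simpa using (this.tendsto 0).mono_left nhdsWithin_le_nhds
  exact ge_of_tendsto ht (by filter_upwards [self_mem_nhdsWithin] with ε h using hε ε h)

/-- A degenerate element of `conformalBase` has rank one, with null range and null co-range. -/
theorem eq_ketBra_of_mem_conformalBase {T : MinkowskiMatrix} (hT : T ∈ conformalBase)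
    (h0 : mink (T *ᵥ timeUnit) (T *ᵥ timeUnit) = 0) :
    T = ketBra (T *ᵥ timeUnit) (minkAdjoint T *ᵥ timeUnit) := by
  obtain ⟨-, h1, h2, -⟩ := hT
  have h2' : ∀ x y, mink (T *ᵥ x) (T *ᵥ y) = 0 := fun x y => by
    rw [← mink_minkAdjoint, mulVec_mulVec, h2, h0]; simp
  refine matrix_ext fun x => ?_
  rw [ketBra_mulVec, mink_minkAdjoint]
  -- The whole range is isotropic, so the difference is a null vector with zero time coordinate.
  refine sub_eq_zero.mp (eq_zero_of_time_eq_zero ⟨?_, ?_⟩ ?_)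
  · rw [← mink_timeUnit (_ - _), map_sub, map_smul, h1]; simp
  · simp only [map_sub, map_smul, LinearMap.sub_apply, LinearMap.smul_apply, h2']
    simp
  · rw [← mink_timeUnit (_ - _), map_sub, map_smul, h1]; simp

/-! ### Lifting ensembles through conformal maps. -/

/-- Elements of `conformalBase` lift decompositions of the image of the time unit. -/
theorem exists_lift_of_mem_conformalBase {T : MinkowskiMatrix} (hT : T ∈ conformalBase) {n : ℕ}
    {b : Fin n → Minkowski} (hb : ∀ i, b i ∈ lorentzCone) (hsum : ∑ i, b i = T *ᵥ timeUnit) :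
    ∃ x : Fin n → Minkowski, (∀ i, x i ∈ lorentzCone) ∧ ∑ i, x i = timeUnit ∧
      ∀ i, T *ᵥ x i = b i := by
  obtain ⟨hP, h1, h2, h3⟩ := id hT
  have hz := hP _ timeUnit_mem
  rcases hz.2.eq_or_lt with h0 | h0
  · have hK := eq_ketBra_of_mem_conformalBase hT h0.symm
    have hz0 : T *ᵥ timeUnit ≠ 0 := fun h => by simp [h] at h1
    rw [mink_timeUnit] at h1
    have hbi : ∀ i, b i = (b i) (.inl ()) • (T *ᵥ timeUnit) := fun i => by
      have := eq_smul_of_sub_mem hz hz0 h0.symm (hb i) (by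
        rw [← hsum, ← Finset.sum_erase_eq_sub (Finset.mem_univ i)]
        exact sum_mem fun j _ => hb j)
      rwa [h1, div_one] at this
    -- Since `T *ᵥ timeUnit` is extreme, each `b i` is a multiple of it, and the same multiple of
    -- `timeUnit` is a lift.
    refine ⟨fun i => (b i) (.inl ()) • timeUnit, fun i => PointedCone.smul_mem _ (hb i).1
      timeUnit_mem, ?_, fun i => ?_⟩
    · rw [← Finset.sum_smul]
      have := congrFun hsum (.inl ())
      rw [Finset.sum_apply, h1] at this
      rw [this, one_smul]
    · rw [mulVec_smul, ← hbi]
  · set c := mink (T *ᵥ timeUnit) (T *ᵥ timeUnit) with hc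
    -- Here `c⁻¹ • minkAdjoint T` is the inverse of `T`, and it is positive.
    refine ⟨fun i => c⁻¹ • (minkAdjoint T *ᵥ b i), fun i => PointedCone.smul_mem _
      (inv_nonneg.mpr h0.le) (minkAdjoint_mem hP _ (hb i)), ?_, fun i => ?_⟩
    · rw [← Finset.smul_sum, ← mulVec_sum, hsum, mulVec_mulVec, h2, smul_mulVec, one_mulVec,
        smul_smul, inv_mul_cancel₀ h0.ne', one_smul]
    · rw [mulVec_smul, mulVec_mulVec, h3, smul_mulVec, one_mulVec, smul_smul,
        inv_mul_cancel₀ h0.ne', one_smul]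

/-! ### Null vectors and extreme rays. -/

/-- Normalized null vectors. -/
def nullBase : Set Minkowski := {x | x ∈ lorentzBase ∧ mink x x = 0}

theorem nullBase_ne_zero {x : Minkowski} (hx : x ∈ nullBase) : x ≠ 0 := fun h => by
  simp [h, nullBase, lorentzBase] at hx

theorem isCompact_nullBase : IsCompact nullBase :=
  isCompact_lorentzBase.inter_right (isClosed_eq continuous_mink_self continuous_const)

theorem elim_mem_nullBase {v : Fin 3 → ℝ} (hv : v ⬝ᵥ v = 1) :
    (Sum.elim (fun _ => 1) v : Minkowski) ∈ nullBase := by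
  have h : mink (Sum.elim (fun _ => 1) v) (Sum.elim (fun _ => 1) v) = 0 := by
    rw [mink_elim, hv]; norm_num
  exact ⟨⟨⟨zero_le_one, h.ge⟩, rfl⟩, h⟩

/-- A cone vector is a nonnegative combination of the two null vectors in its own and the opposite
spatial direction `± v`. -/
theorem lorentzCone_le_hull : lorentzCone ≤ PointedCone.hull ℝ nullBase := by
  intro x hx
  obtain ⟨v, r, hv, hr, hxr⟩ : ∃ (v : Fin 3 → ℝ) (r : ℝ), v ⬝ᵥ v = 1 ∧ 0 ≤ r ∧
      x ∘ Sum.inr = r • v := by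
    have h0 : 0 ≤ (x ∘ Sum.inr) ⬝ᵥ (x ∘ Sum.inr) :=
      Finset.sum_nonneg fun _ _ => mul_self_nonneg _
    rcases h0.eq_or_lt with h | h
    · refine ⟨Pi.single 0 1, 0, by simp, le_rfl, ?_⟩
      rw [zero_smul]
      exact dotProduct_self_eq_zero.mp h.symm
    · have hr := Real.sqrt_pos.mpr h
      refine ⟨(√((x ∘ Sum.inr) ⬝ᵥ (x ∘ Sum.inr)))⁻¹ • (x ∘ Sum.inr), _, ?_, hr.le, ?_⟩
      · rw [smul_dotProduct, dotProduct_smul, smul_smul, smul_eq_mul, ← mul_inv,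
          Real.mul_self_sqrt h0, inv_mul_cancel₀ h.ne']
      · rw [smul_smul, mul_inv_cancel₀ hr.ne', one_smul]
  have hx' : x = Sum.elim (fun _ => x (.inl ())) (r • v) := by
    rw [← hxr]
    exact (Sum.elim_comp_inl_inr x).symm
  have hq := hx.2
  rw [hx', mink_elim, dotProduct_smul, smul_dotProduct, hv] at hq
  simp only [smul_eq_mul, mul_one] at hq
  have hle : r ≤ x (.inl ()) := abs_le_of_sq_le_sq' (by nlinarith) hx.1 |>.2
  have key : x = ((x (.inl ()) + r) / 2) • Sum.elim (fun _ => 1) v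
      + ((x (.inl ()) - r) / 2) • Sum.elim (fun _ => 1) (-v) := by
    rw [hx']
    ext (i | i)
    · simp; ring
    · simp; ring
  rw [key]
  have hn : (-v) ⬝ᵥ (-v) = 1 := by simpa using hv
  exact add_mem
    (PointedCone.smul_mem _ (by linarith [hx.1]) (Submodule.subset_span (elim_mem_nullBase hv)))
    (PointedCone.smul_mem _ (by linarith) (Submodule.subset_span (elim_mem_nullBase hn)))

theorem mem_positiveMaps_of_nullBase {T : MinkowskiMatrix}
    (h : ∀ a ∈ nullBase, ∀ b ∈ nullBase, 0 ≤ mink b (T *ᵥ a)) : T ∈ positiveMaps := by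
  intro x hx
  refine mem_lorentzCone_of_forall fun y hy => ?_
  rw [mink_comm]
  have h1 : ∀ a ∈ nullBase, 0 ≤ mink y (T *ᵥ a) := fun a ha => by
    have := nonneg_of_mem_hull (φ := mink (T *ᵥ a))
      (fun b hb => by rw [mink_comm]; exact h a ha b hb) (lorentzCone_le_hull hy)
    rwa [mink_comm]
  exact nonneg_of_mem_hull (φ := mink y ∘ₗ Matrix.mulVecLin T) h1 (lorentzCone_le_hull hx)

/-- The cone has interior: `timeUnit + s • x` lies in it for some `s > 0`. -/
theorem mulVec_eq_of_eqOn_lorentzCone {S T : MinkowskiMatrix}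
    (h : ∀ x ∈ lorentzCone, S *ᵥ x = T *ᵥ x) : S = T := by
  refine matrix_ext fun x => ?_
  have hev := eventually_add_smul_mem timeUnit_mem
    (by rw [mink_timeUnit_self]; exact one_pos) x
  obtain ⟨s, hs, hs0⟩ := ((hev.filter_mono nhdsWithin_le_nhds).and
    (self_mem_nhdsWithin : Set.Ioi (0 : ℝ) ∈ 𝓝[>] 0)).exists
  have h1 := h _ hs
  rw [mulVec_add, mulVec_add, h _ timeUnit_mem, add_right_inj, mulVec_smul, mulVec_smul] at h1
  exact smul_right_injective _ (ne_of_gt hs0) h1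

/-- The identity generates an extreme ray of the cone of positive maps. -/
theorem eq_smul_one_of_sub_mem {X : MinkowskiMatrix} (hX : X ∈ positiveMaps)
    (h1 : 1 - X ∈ positiveMaps) : ∃ c : ℝ, X = c • 1 := by
  -- Every null vector is extreme, hence an eigenvector of `X`; the six null vectors along the
  -- coordinate axes already force `X` to be scalar.
  have key : ∀ v : Fin 3 → ℝ, v ⬝ᵥ v = 1 → ∃ l : ℝ,
      X *ᵥ Sum.elim (fun _ => 1) v = l • Sum.elim (fun _ => 1) v := fun v hv => by
    have hn := elim_mem_nullBase hv
    have h := h1 _ hn.1.1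
    rw [sub_mulVec, one_mulVec] at h
    exact ⟨_, eq_smul_of_sub_mem hn.1.1 (nullBase_ne_zero hn) hn.2 (hX _ hn.1.1) h⟩
  have hent : ∀ i : Fin 3, (∀ k ≠ i, X (.inr k) (.inl ()) = 0 ∧ X (.inr k) (.inr i) = 0) ∧
      X (.inl ()) (.inr i) = X (.inr i) (.inl ()) ∧
      X (.inr i) (.inr i) = X (.inl ()) (.inl ()) := fun i => by
    obtain ⟨l, hl⟩ := key (Pi.single i 1) (by simp)
    obtain ⟨m, hm⟩ := key (-Pi.single i 1) (by simp)
    have el : ∀ k, X k (.inl ()) + X k (.inr i)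
        = l * (Sum.elim (fun _ => 1) (Pi.single i 1) : Minkowski) k := fun k => by
      have := congrFun hl k
      simpa [mulVec, dotProduct, Pi.single_apply] using this
    have em : ∀ k, X k (.inl ()) - X k (.inr i)
        = m * (Sum.elim (fun _ => 1) (-Pi.single i 1) : Minkowski) k := fun k => by
      have := congrFun hm k
      simpa [mulVec, dotProduct, Pi.single_apply, sub_eq_add_neg] using this
    refine ⟨fun k hk => ?_, ?_⟩
    · have h1 := el (.inr k)
      have h2 := em (.inr k)
      simp [hk] at h1 h2
      exact ⟨by linarith, by linarith⟩
    · have h1 := el (.inr i)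
      have h2 := em (.inr i)
      have h3 := el (.inl ())
      have h4 := em (.inl ())
      simp at h1 h2 h3 h4
      exact ⟨by linarith, by linarith⟩
  have hz : ∀ k : Fin 3, X (.inr k) (.inl ()) = 0 := fun k => by
    obtain ⟨i, hi⟩ := exists_ne k
    exact ((hent i).1 k hi.symm).1
  refine ⟨X (.inl ()) (.inl ()), ?_⟩
  ext (i | i) (j | j)
  · simp
  · simp [(hent j).2.1, hz]
  · simp [hz]
  · by_cases hij : i = j
    · subst hij
      simp [(hent i).2.2]
    · simp [((hent j).1 i hij).2, hij]

/-- Each value `X x` is dominated by a multiple of the null vector `z`, so it lies on the ray of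
`z`; its time coordinate gives the co-vector. -/
theorem exists_eq_ketBra_of_sub_mem {z w : Minkowski} (hz : z ∈ nullBase)
    {X : MinkowskiMatrix} (hX : X ∈ positiveMaps) (h1 : ketBra z w - X ∈ positiveMaps) :
    X = ketBra z (minkAdjoint X *ᵥ timeUnit) := by
  refine mulVec_eq_of_eqOn_lorentzCone fun x hx => ?_
  have hXx := hX x hx
  rw [ketBra_mulVec, mink_minkAdjoint, mink_timeUnit]
  have h := h1 x hx
  rw [sub_mulVec, ketBra_mulVec] at h
  have h0 : mink z (X *ᵥ x) = 0 := by
    refine le_antisymm ?_ (mink_nonneg hz.1.1 hXx)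
    have := mink_nonneg hz.1.1 h
    rw [map_sub, map_smul, hz.2, smul_zero, zero_sub] at this
    linarith
  have := eq_smul_of_mink_eq_zero hz.1.1 (nullBase_ne_zero hz) hXx h0
  rwa [hz.1.2, div_one] at this

/-- Rank one maps with null range and null co-range generate extreme rays of the cone of
positive maps. -/
theorem eq_smul_ketBra_of_sub_mem {z w : Minkowski} (hz : z ∈ nullBase) (hw : w ∈ nullBase)
    {X : MinkowskiMatrix} (hX : X ∈ positiveMaps) (h1 : ketBra z w - X ∈ positiveMaps) :
    ∃ c : ℝ, X = c • ketBra z w := by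
  have hX' := exists_eq_ketBra_of_sub_mem hz hX h1
  have hzu : mink timeUnit z = 1 := by rw [mink_timeUnit]; exact hz.1.2
  have hadj : minkAdjoint (ketBra z w - X) *ᵥ timeUnit
      = w - minkAdjoint X *ᵥ timeUnit := mink_ext fun y => by
    rw [mink_minkAdjoint, sub_mulVec, map_sub, map_sub, LinearMap.sub_apply, mink_minkAdjoint,
      ketBra_mulVec, map_smul, hzu, smul_eq_mul, mul_one]
  have hs := minkAdjoint_mem h1 _ timeUnit_mem
  rw [hadj] at hs
  have := eq_smul_of_sub_mem hw.1.1 (nullBase_ne_zero hw) hw.2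
    (minkAdjoint_mem hX _ timeUnit_mem) hs
  refine ⟨(minkAdjoint X *ᵥ timeUnit) (.inl ()) / w (.inl ()), hX'.trans ?_⟩
  rw [this, ketBra, mulVec_smul, vecMulVec_smul, ketBra, ← this]

/-- Splitting a positive multiple of one generator off a nonzero element of the hull locates extreme
rays: for an extreme element, that generator must span its ray. -/
theorem exists_sub_smul_mem_hull {V : Type*} [AddCommGroup V] [Module ℝ V] {S : Set V} {x : V}
    (hx : x ∈ PointedCone.hull ℝ S) (hx0 : x ≠ 0) :
    ∃ s ∈ S, ∃ r : ℝ, 0 < r ∧ x - r • s ∈ PointedCone.hull ℝ S := by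
  revert hx0
  induction hx using Submodule.span_induction with
  | mem x hx => exact fun _ => ⟨x, hx, 1, one_pos, by simp⟩
  | zero => exact fun h => (h rfl).elim
  | add x y hx hy ihx ihy =>
    intro hxy
    by_cases h : x = 0
    · subst h
      simpa using ihy (by simpa using hxy)
    · obtain ⟨s, hs, r, hr, hm⟩ := ihx h
      refine ⟨s, hs, r, hr, ?_⟩
      rw [add_sub_right_comm]
      exact add_mem hm hy
  | smul c x hx ih =>
    intro hcx
    have hc : c ≠ 0 := fun h => hcx (by rw [h, zero_smul])
    obtain ⟨s, hs, r, hr, hm⟩ := ih fun h => hcx (by rw [h, smul_zero])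
    have hc0 : 0 < (c : ℝ) := lt_of_le_of_ne c.2 fun h => hc (Subtype.ext h.symm)
    refine ⟨s, hs, c * r, mul_pos hc0 hr, ?_⟩
    have : c • x - ((c : ℝ) * r) • s = c • (x - r • s) := by
      rw [smul_sub, mul_smul]; rfl
    rw [this]
    exact Submodule.smul_mem _ _ hm

/-! ### The dual cone and failure of weak self-duality. -/

/-- The functionals `T ↦ ⟨b, T a⟩` with `a`, `b` null. -/
def nullProducts : Set (Dual ℝ MinkowskiMatrix) :=
  {f | ∃ a ∈ nullBase, ∃ b ∈ nullBase, f = productFunctional a b}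

/-- The bipolar theorem: positivity of a map can be tested on null pairs, which form a compact
family normalized by evaluation at `ketBra timeUnit timeUnit`. -/
theorem hull_nullProducts {f : Dual ℝ MinkowskiMatrix} :
    f ∈ PointedCone.hull ℝ nullProducts ↔ f ∈ dualCone positiveMaps := by
  constructor
  · intro hf T hT
    refine nonneg_of_mem_hull (φ := Dual.eval ℝ _ T) ?_ hf
    rintro _ ⟨a, ha, b, hb, rfl⟩
    exact mink_nonneg hb.1.1 (hT a ha.1.1)
  · intro hf
    have : CompactSpace nullBase := isCompact_iff_compactSpace.mp isCompact_nullBase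
    have h := mem_hull_range_of_forall_dual
      (k := fun p : nullBase × nullBase => productFunctional p.1 p.2)
      (u := Dual.eval ℝ _ (ketBra timeUnit timeUnit)) (v := f) (fun φ => ?_) (fun p => ?_)
      fun φ hφ => ?_
    · refine Submodule.span_mono ?_ h
      rintro _ ⟨p, rfl⟩
      exact ⟨p.1, p.1.2, p.2, p.2.2, rfl⟩
    · obtain ⟨T, rfl⟩ := (evalEquiv ℝ MinkowskiMatrix).surjective φ
      have h1 : ∀ i, Continuous fun p : nullBase × nullBase => (p.1 : Minkowski) i :=
        fun i => (continuous_apply i).comp (continuous_subtype_val.comp continuous_fst)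
      have h2 : ∀ i, Continuous fun p : nullBase × nullBase => (p.2 : Minkowski) i :=
        fun i => (continuous_apply i).comp (continuous_subtype_val.comp continuous_snd)
      simp only [evalEquiv_apply, Dual.eval_apply, productFunctional_apply, mink_apply, mulVec,
        dotProduct]
      fun_prop
    · rw [Dual.eval_apply, productFunctional_apply, ketBra_mulVec, map_smul,
        mink_comm _ timeUnit, mink_timeUnit, mink_timeUnit, p.1.2.1.2, p.2.2.1.2]
      simp
    · obtain ⟨T, rfl⟩ := (evalEquiv ℝ MinkowskiMatrix).surjective φ
      exact hf (mem_positiveMaps_of_nullBase fun a ha b hb => hφ (⟨a, ha⟩, ⟨b, hb⟩))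

theorem productFunctional_mem {a b : Minkowski} (ha : a ∈ nullBase) (hb : b ∈ nullBase) :
    productFunctional a b ∈ dualCone positiveMaps :=
  hull_nullProducts.mp (Submodule.subset_span ⟨a, ha, b, hb, rfl⟩)

theorem ketBra_ne_zero {z w : Minkowski} (hz : z ∈ nullBase) (hw : w ∈ nullBase) :
    ketBra z w ≠ 0 := fun h => by
  have h1 : mink timeUnit (ketBra z w *ᵥ timeUnit) = 1 := by
    rw [ketBra_mulVec, map_smul, mink_comm w, mink_timeUnit, mink_timeUnit, hz.1.2, hw.1.2]
    simp
  simp [h] at h1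

/-- The Lorentz cone-preserving maps do not form a weakly self-dual cone. -/
theorem not_weaklySelfDual_positiveMaps : ¬ WeaklySelfDual positiveMaps := by
  rintro ⟨η, hη⟩
  have hη' : ∀ X, η.symm X ∈ dualCone positiveMaps ↔ X ∈ positiveMaps := fun X => by
    rw [← hη, LinearEquiv.apply_symm_apply]
  have h1P : (1 : MinkowskiMatrix) ∈ positiveMaps := fun x hx => by rwa [one_mulVec]
  -- the preimage of the identity is a product functional
  obtain ⟨a, ha, b, hb, c, hc⟩ : ∃ a ∈ nullBase, ∃ b ∈ nullBase, ∃ c : ℝ,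
      η.symm 1 = c • productFunctional a b := by
    have hs := hull_nullProducts.mpr ((hη' 1).mpr h1P)
    obtain ⟨_, ⟨a, ha, b, hb, rfl⟩, r, hr, hm⟩ := exists_sub_smul_mem_hull hs (by simp)
    have hrf : r • productFunctional a b ∈ dualCone positiveMaps :=
      PointedCone.smul_mem _ hr.le (productFunctional_mem ha hb)
    have h2 := (hη _).mpr (hull_nullProducts.mp hm)
    rw [map_sub, LinearEquiv.apply_symm_apply] at h2
    -- Extremality of the identity makes the image of the split-off product a multiple of it.
    obtain ⟨c, hc⟩ := eq_smul_one_of_sub_mem ((hη _).mpr hrf) h2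
    have hc0 : c ≠ 0 := by
      rintro rfl
      rw [zero_smul, LinearEquiv.map_eq_zero_iff, smul_eq_zero_iff_right hr.ne'] at hc
      have := congrArg (fun f : Dual ℝ MinkowskiMatrix => f (ketBra timeUnit timeUnit)) hc
      simp [productFunctional_apply, ketBra_mulVec, mink_timeUnit, mink_comm _ timeUnit,
        ha.1.2, hb.1.2] at this
    refine ⟨a, ha, b, hb, c⁻¹ * r, ?_⟩
    rw [LinearEquiv.symm_apply_eq, mul_smul, map_smul, hc, smul_smul, inv_mul_cancel₀ hc0,
      one_smul]
  -- the dual transformation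
  let g : Minkowski → Dual ℝ MinkowskiMatrix := fun w =>
    Dual.eval ℝ _ (ketBra b w) ∘ₗ η.symm.toLinearMap
  have hg : ∀ w X, g w X = η.symm X (ketBra b w) := fun _ _ => rfl
  -- Extremality of `ketBra b w` makes `g w` a multiple of one product; its two factors agree
  -- because `g w` vanishes at the identity, `b` being null.
  have hgprod : ∀ w ∈ nullBase, ∃ x ∈ nullBase, ∃ r : ℝ, r ≠ 0 ∧
      g w = r • productFunctional x x := by
    intro w hw
    have hgw : g w ∈ dualCone positiveMaps := fun X hX =>
      (hη' X).mpr hX (ketBra_mem hb.1.1 hw.1.1)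
    have hg0 : g w ≠ 0 := fun h => by
      refine ketBra_ne_zero hb hw ((forall_dual_apply_eq_zero_iff ℝ _).mp fun f => ?_)
      have := hg w (η f)
      rwa [h, LinearEquiv.symm_apply_apply, LinearMap.zero_apply, eq_comm] at this
    obtain ⟨_, ⟨x, hx, y, hy, rfl⟩, r, hr, hm⟩ :=
      exists_sub_smul_mem_hull (hull_nullProducts.mpr hgw) hg0
    have hm' := hull_nullProducts.mp hm
    have hxy : y = x := by
      -- Evaluation at the identity gives `-r * ⟨y, x⟩ ≥ 0`, so the null vectors `x` and `y` are
      -- orthogonal and therefore equal.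
      have h1 := hm' h1P
      have hg1 : g w 1 = 0 := by
        rw [hg, hc, LinearMap.smul_apply, productFunctional_apply, ketBra_mulVec, map_smul, hb.2]
        simp
      simp only [Dual.eval_apply, LinearMap.sub_apply, LinearMap.smul_apply, hg1,
        productFunctional_apply, one_mulVec, smul_eq_mul, zero_sub] at h1
      have h0 : mink x y = 0 := by
        rw [mink_comm]
        have := mink_nonneg hy.1.1 hx.1.1
        nlinarith
      have := eq_smul_of_mink_eq_zero hx.1.1 (nullBase_ne_zero hx) hy.1.1 h0
      rwa [hx.1.2, hy.1.2, div_one, one_smul] at this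
    subst hxy
    -- transport back to the cone of positive maps
    set h := r • productFunctional y y with hh
    let X := (evalEquiv ℝ MinkowskiMatrix).symm (h ∘ₗ η.toLinearMap)
    have hX : ∀ f : Dual ℝ MinkowskiMatrix, f X = h (η f) := fun f => by
      simp only [X, apply_evalEquiv_symm_apply]
      rfl
    have hgf : ∀ f, g w (η f) = f (ketBra b w) := fun f => by
      rw [hg, LinearEquiv.symm_apply_apply]
    have hhP : h ∈ dualCone positiveMaps :=
      PointedCone.smul_mem _ hr.le (productFunctional_mem hx hx)
    have hXP : X ∈ positiveMaps := mem_positiveMaps_of_nullBase fun p hp q hq => by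
      rw [← productFunctional_apply, hX]
      exact hhP ((hη _).mpr (productFunctional_mem hp hq))
    have hXP' : ketBra b w - X ∈ positiveMaps := mem_positiveMaps_of_nullBase fun p hp q hq => by
      rw [← productFunctional_apply, map_sub, hX, ← hgf]
      exact hm' ((hη _).mpr (productFunctional_mem hp hq))
    obtain ⟨d, hd⟩ := eq_smul_ketBra_of_sub_mem hb hw hXP hXP'
    have hhd : h = d • g w := LinearMap.ext fun Y => by
      obtain ⟨f, rfl⟩ := η.surjective Y
      rw [← hX, hd, LinearMap.smul_apply, hgf, map_smul]
    have hd0 : d ≠ 0 := by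
      rintro rfl
      have h1 := LinearMap.congr_fun hhd (ketBra timeUnit timeUnit)
      simp [hh, productFunctional_apply, ketBra_mulVec, mink_timeUnit, mink_comm _ timeUnit,
        hx.1.2, hr.ne'] at h1
    refine ⟨y, hx, d⁻¹ * r, mul_ne_zero (inv_ne_zero hd0) hr.ne', ?_⟩
    rw [mul_smul, ← hh, hhd, smul_smul, inv_mul_cancel₀ hd0, one_smul]
  have hginj : ∀ w₁ ∈ nullBase, ∀ w₂ ∈ nullBase, ∀ s : ℝ, g w₁ = s • g w₂ → w₁ = w₂ := by
    intro w₁ hw₁ w₂ hw₂ s h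
    have h1 : ketBra b w₁ = s • ketBra b w₂ := by
      rw [← sub_eq_zero]
      refine (forall_dual_apply_eq_zero_iff ℝ _).mp fun f => ?_
      have := LinearMap.congr_fun h (η f)
      rw [LinearMap.smul_apply, hg, hg, LinearEquiv.symm_apply_apply] at this
      rw [map_sub, map_smul, this, sub_self]
    have h2 : w₁ = s • w₂ := mink_ext fun y => by
      have := congrFun (congrArg (· *ᵥ y) h1) (.inl ())
      simpa [ketBra_mulVec, smul_mulVec, hb.1.2] using this
    have h3 := congrFun h2 (.inl ())
    rw [Pi.smul_apply, hw₁.1.2, hw₂.1.2, smul_eq_mul, mul_one] at h3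
    rw [h2, ← h3, one_smul]
  let n : (Fin 3 → ℝ) → Minkowski := fun v => Sum.elim (fun _ => 1) v
  have hn : ∀ i : Fin 3, ∀ s : ℝ, s * s = 1 → n (Pi.single i s) ∈ nullBase := fun i s hs =>
    elim_mem_nullBase (by simp [hs])
  have h1 : (1 : ℝ) * 1 = 1 := by norm_num
  have h2 : (-1 : ℝ) * -1 = 1 := by norm_num
  -- Two antipodal pairs of null vectors have the same sum, twice `timeUnit`.
  have hsum : g (n (Pi.single 0 1)) + g (n (Pi.single 0 (-1)))
      = g (n (Pi.single 1 1)) + g (n (Pi.single 1 (-1))) := by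
    have hadd : ∀ w w', g w + g w' = g (w + w') := fun w w' => LinearMap.ext fun X => by
      rw [LinearMap.add_apply, hg, hg, hg, ketBra_add, map_add]
    rw [hadd, hadd]
    congr 1
    ext (i | i)
    · rfl
    · simp [n, Pi.single_apply]
      split_ifs <;> simp
  obtain ⟨x₁, hx₁, r₁, hr₁, e₁⟩ := hgprod _ (hn 0 1 h1)
  obtain ⟨x₂, hx₂, r₂, hr₂, e₂⟩ := hgprod _ (hn 0 (-1) h2)
  obtain ⟨x₃, hx₃, r₃, hr₃, e₃⟩ := hgprod _ (hn 1 1 h1)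
  -- The test map `ketBra x₁ x₂` kills the products for `x₁` and `x₂`. By positivity it kills the
  -- third as well, which forces `x₃` to equal `x₁` or `x₂` and contradicts injectivity.
  have hT := ketBra_mem hx₁.1.1 hx₂.1.1
  have hpos : ∀ w ∈ nullBase, 0 ≤ g w (ketBra x₁ x₂) := fun w hw =>
    (hη' _).mpr hT (ketBra_mem hb.1.1 hw.1.1)
  have hval := LinearMap.congr_fun hsum (ketBra x₁ x₂)
  have hp4 := hpos _ (hn 1 (-1) h2)
  have hp3 := hpos _ (hn 1 1 h1)
  rw [LinearMap.add_apply, LinearMap.add_apply, e₁, e₂] at hval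
  simp only [LinearMap.smul_apply, productFunctional_apply, ketBra_mulVec, map_smul, hx₁.2, hx₂.2,
    smul_eq_mul, mul_zero, zero_mul, add_zero] at hval
  have hz : g (n (Pi.single 1 1)) (ketBra x₁ x₂) = 0 := by linarith
  rw [e₃, LinearMap.smul_apply, productFunctional_apply, ketBra_mulVec, map_smul, smul_eq_mul,
    smul_eq_mul, mul_eq_zero, mul_eq_zero] at hz
  have hnull : ∀ x ∈ nullBase, ∀ y ∈ nullBase, mink x y = 0 → y = x := fun x hx y hy h => by
    have := eq_smul_of_mink_eq_zero hx.1.1 (nullBase_ne_zero hx) hy.1.1 h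
    rwa [hx.1.2, hy.1.2, div_one, one_smul] at this
  have hne : ∀ s : ℝ, n (Pi.single 1 1) ≠ n (Pi.single 0 s) := fun s h => by
    have := congrFun h (.inr 1)
    simp [n] at this
  rcases hz with h | h | h
  · exact hr₃ h
  · have := hnull _ hx₂ _ hx₃ h
    subst this
    exact hne _ (hginj _ (hn 1 1 h1) _ (hn 0 (-1) h2) (r₃ * r₂⁻¹) (by
      rw [e₂, e₃, smul_smul, inv_mul_cancel_right₀ hr₂]))
  · have := hnull _ hx₃ _ hx₁ h
    subst this
    exact hne _ (hginj _ (hn 1 1 h1) _ (hn 0 1 h1) (r₃ * r₁⁻¹) (by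
      rw [e₁, e₃, smul_smul, inv_mul_cancel_right₀ hr₁]))

/-! ### Pauli coordinates for the qubit. -/

/-- The matrix with Pauli coordinates `x`, normalized so that the time coordinate is the trace. -/
noncomputable def pauliMatrix (x : Minkowski) : Matrix (Fin 2) (Fin 2) ℂ :=
  !![((x (.inl ()) + x (.inr 2)) / 2 : ℝ), Complex.mk (x (.inr 0) / 2) (-(x (.inr 1) / 2));
    Complex.mk (x (.inr 0) / 2) (x (.inr 1) / 2), ((x (.inl ()) - x (.inr 2)) / 2 : ℝ)]

theorem isSelfAdjoint_pauliMatrix (x : Minkowski) :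
    pauliMatrix x ∈ selfAdjoint (Matrix (Fin 2) (Fin 2) ℂ) := by
  rw [selfAdjoint.mem_iff, star_eq_conjTranspose]
  ext i j
  fin_cases i <;> fin_cases j <;> simp [pauliMatrix, Complex.ext_iff]

/-- Pauli coordinates on the space of Hermitian `2 × 2` matrices. -/
noncomputable def pauli : Minkowski ≃ₗ[ℝ] Herm (Fin 2) where
  toFun x := ⟨pauliMatrix x, isSelfAdjoint_pauliMatrix x⟩
  map_add' x y := by
    ext i j
    fin_cases i <;> fin_cases j <;> simp [pauliMatrix, Complex.ext_iff] <;> ring_nf <;> simp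
  map_smul' c x := by
    ext i j
    fin_cases i <;> fin_cases j <;> simp [pauliMatrix, Complex.ext_iff] <;> ring_nf <;> simp
  invFun h := Sum.elim (fun _ => (h.1 0 0).re + (h.1 1 1).re)
    ![2 * (h.1 1 0).re, 2 * (h.1 1 0).im, (h.1 0 0).re - (h.1 1 1).re]
  left_inv x := by
    ext (i | i)
    · simp [pauliMatrix]; ring
    · fin_cases i <;> simp [pauliMatrix] <;> ring
  right_inv h := by
    have hh : ∀ i j, star (h.1 j i) = h.1 i j := fun i j => by
      have h' : star (h : Matrix (Fin 2) (Fin 2) ℂ) = h := selfAdjoint.mem_iff.mp h.2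
      exact congrFun (congrFun h' i) j
    have h00 := congrArg Complex.im (hh 0 0)
    have h11 := congrArg Complex.im (hh 1 1)
    have h01 := hh 0 1
    ext i j
    fin_cases i <;> fin_cases j <;> simp [pauliMatrix, Complex.ext_iff] at h00 h11 h01 ⊢
    · linarith
    · exact h01
    · linarith

theorem coe_pauli (x : Minkowski) :
    (pauli x : Matrix (Fin 2) (Fin 2) ℂ) = pauliMatrix x := rfl

theorem trace_pauli (x : Minkowski) :
    (pauli x : Matrix (Fin 2) (Fin 2) ℂ).trace = (x (.inl ()) : ℝ) := by
  rw [coe_pauli, pauliMatrix, trace_fin_two_of, ← Complex.ofReal_add]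
  congr 1
  ring

theorem det_pauli (x : Minkowski) :
    (pauli x : Matrix (Fin 2) (Fin 2) ℂ).det = (mink x x / 4 : ℝ) := by
  rw [coe_pauli, pauliMatrix, det_fin_two_of, mink_apply, Fin.sum_univ_three]
  apply Complex.ext
  · simp; ring
  · simp; ring

theorem posSemidef_fin_two_iff {A : Matrix (Fin 2) (Fin 2) ℂ} (hA : A.IsHermitian) :
    A.PosSemidef ↔ 0 ≤ A.trace ∧ 0 ≤ A.det := by
  refine ⟨fun h => ⟨h.trace_nonneg, h.det_nonneg⟩, fun ⟨h1, h2⟩ => ?_⟩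
  rw [hA.posSemidef_iff_eigenvalues_nonneg]
  rw [hA.trace_eq_sum_eigenvalues, Fin.sum_univ_two] at h1
  rw [hA.det_eq_prod_eigenvalues, Fin.prod_univ_two] at h2
  have h1' : 0 ≤ hA.eigenvalues 0 + hA.eigenvalues 1 :=
    Complex.zero_le_real.mp (by push_cast; exact h1)
  have h2' : 0 ≤ hA.eigenvalues 0 * hA.eigenvalues 1 :=
    Complex.zero_le_real.mp (by push_cast; exact h2)
  intro i
  fin_cases i
  · by_contra h
    simp at h
    nlinarith
  · by_contra h
    simp at h
    nlinarith

/-- For a Hermitian `2 × 2` matrix positivity is read off trace and determinant, which are here `x₀`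
and `⟨x, x⟩ / 4`. -/
theorem pauli_mem_cone {x : Minkowski} : pauli x ∈ qubit.cone ↔ x ∈ lorentzCone := by
  have hH : (pauli x : Matrix (Fin 2) (Fin 2) ℂ).IsHermitian := (pauli x).2
  change (pauli x : Matrix (Fin 2) (Fin 2) ℂ).PosSemidef ↔ _
  rw [posSemidef_fin_two_iff hH, trace_pauli, det_pauli, mem_lorentzCone]
  refine and_congr (by exact_mod_cast Iff.rfl) ?_
  rw [Complex.zero_le_real]
  constructor <;> intro h <;> linarith

/-- The Minkowski form identifies Minkowski space with the dual of the space of Hermitian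
`2 × 2` matrices. -/
noncomputable def pauliDual : Minkowski ≃ₗ[ℝ] Dual ℝ (Herm (Fin 2)) :=
  LinearMap.linearEquivOfInjective (pauli.symm.toLinearMap.dualMap ∘ₗ mink) (by
    rw [← LinearMap.ker_eq_bot, LinearMap.ker_eq_bot']
    intro x hx
    refine mink_nondegenerate fun y => ?_
    simpa using LinearMap.congr_fun hx (pauli y))
    (by rw [Subspace.dual_finrank_eq, pauli.finrank_eq])

theorem pauliDual_apply_pauli (a x : Minkowski) : pauliDual a (pauli x) = mink a x := by
  simp [pauliDual]

theorem pauliDual_timeUnit : pauliDual timeUnit = qubit.unit := by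
  ext h
  obtain ⟨x, rfl⟩ := pauli.surjective h
  rw [pauliDual_apply_pauli, mink_timeUnit]
  change _ = (pauli x : Matrix (Fin 2) (Fin 2) ℂ).trace.re
  rw [trace_pauli, Complex.ofReal_re]

theorem pauliDual_mem_dualCone {a : Minkowski} :
    pauliDual a ∈ dualCone qubit.cone ↔ a ∈ lorentzCone := by
  constructor
  · intro h
    refine mem_lorentzCone_of_forall fun x hx => ?_
    rw [← pauliDual_apply_pauli]
    exact h (pauli_mem_cone.mpr hx)
  · intro ha h hh
    obtain ⟨x, rfl⟩ := pauli.surjective h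
    rw [Dual.eval_apply, pauliDual_apply_pauli]
    exact mink_nonneg ha (pauli_mem_cone.mp hh)

/-! ### Two-qubit states as maps of Minkowski space. -/

/-- Two-qubit bilinear forms as matrices acting on Minkowski space. -/
noncomputable def bilinOfMatrix :
    MinkowskiMatrix ≃ₗ[ℝ] Bilin (Herm (Fin 2)) (Herm (Fin 2)) :=
  Matrix.toLin'.trans (LinearEquiv.arrowCongr pauliDual (pauli.trans (evalEquiv ℝ _)))

theorem hat_bilinOfMatrix (T : MinkowskiMatrix) (a : Minkowski) :
    hat (bilinOfMatrix T) (pauliDual a) = pauli (T *ᵥ a) := by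
  refine (evalEquiv ℝ (Herm (Fin 2))).injective ?_
  simp [hat, bilinOfMatrix, LinearEquiv.arrowCongr_apply]

theorem bilinOfMatrix_apply (T : MinkowskiMatrix) (a b : Minkowski) :
    bilinOfMatrix T (pauliDual a) (pauliDual b) = mink b (T *ᵥ a) := by
  rw [← apply_hat, hat_bilinOfMatrix, pauliDual_apply_pauli]

theorem bilinOfMatrix_flip (T : MinkowskiMatrix) :
    (bilinOfMatrix T).flip = bilinOfMatrix (minkAdjoint T) := by
  ext f g
  obtain ⟨a, rfl⟩ := pauliDual.surjective f
  obtain ⟨b, rfl⟩ := pauliDual.surjective g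
  rw [LinearMap.flip_apply, bilinOfMatrix_apply, bilinOfMatrix_apply, mink_minkAdjoint', mink_comm]

theorem bilinOfMatrix_mem_maxTensor {T : MinkowskiMatrix} :
    bilinOfMatrix T ∈ (maxTensor qubit qubit).cone ↔ T ∈ positiveMaps := by
  constructor
  · intro h x hx
    refine mem_lorentzCone_of_forall fun y hy => ?_
    rw [mink_comm, ← bilinOfMatrix_apply]
    exact h _ (pauliDual_mem_dualCone.mpr hx) _ (pauliDual_mem_dualCone.mpr hy)
  · intro h f hf g hg
    obtain ⟨a, rfl⟩ := pauliDual.surjective f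
    obtain ⟨b, rfl⟩ := pauliDual.surjective g
    rw [bilinOfMatrix_apply]
    exact mink_nonneg (pauliDual_mem_dualCone.mp hg) (h _ (pauliDual_mem_dualCone.mp hf))

theorem isBipartiteState_bilinOfMatrix {T : MinkowskiMatrix} (hT : T ∈ conformalBase) :
    IsBipartiteState qubit qubit (bilinOfMatrix T) := by
  refine ⟨bilinOfMatrix_mem_maxTensor.mpr hT.1, ?_⟩
  change bilinOfMatrix T qubit.unit qubit.unit = 1
  rw [← pauliDual_timeUnit, bilinOfMatrix_apply, hT.2.1]

theorem steersSecond_bilinOfMatrix {T : MinkowskiMatrix} (hT : T ∈ conformalBase) :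
    SteersSecond qubit qubit (bilinOfMatrix T) := by
  rintro n b ⟨hb, hsum⟩
  rw [← pauliDual_timeUnit, hat_bilinOfMatrix] at hsum
  obtain ⟨x, hx, hxu, hxb⟩ := exists_lift_of_mem_conformalBase hT (b := fun i => pauli.symm (b i))
    (fun i => by rw [← pauli_mem_cone, LinearEquiv.apply_symm_apply]; exact hb i)
    (by rw [← map_sum, hsum, LinearEquiv.symm_apply_apply])
  refine ⟨fun i => pauliDual (x i), ⟨fun i => ⟨pauliDual_mem_dualCone.mpr (hx i), ?_⟩, ?_⟩,
    fun i => ?_⟩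
  -- The complement of one effect is the sum of the others.
  · rw [← pauliDual_timeUnit, ← map_sub, pauliDual_mem_dualCone, ← hxu,
      ← Finset.sum_erase_eq_sub (Finset.mem_univ i)]
    exact sum_mem fun j _ => hx j
  · rw [← map_sum, hxu, pauliDual_timeUnit]
  · rw [hat_bilinOfMatrix, hxb, LinearEquiv.apply_symm_apply]

theorem steersFirst_bilinOfMatrix {T : MinkowskiMatrix} (hT : T ∈ conformalBase) :
    SteersFirst qubit qubit (bilinOfMatrix T) := by
  rw [SteersFirst, bilinOfMatrix_flip]
  exact steersSecond_bilinOfMatrix (minkAdjoint_mem_conformalBase hT)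

theorem maxTensor_cone_le_bisteeringProduct :
    (maxTensor qubit qubit).cone ≤ (bisteeringProduct qubit qubit).cone := by
  intro ω hω
  obtain ⟨T, rfl⟩ := bilinOfMatrix.surjective ω
  have hle : PointedCone.hull ℝ conformalBase ≤
      PointedCone.comap bilinOfMatrix.toLinearMap (bisteeringProduct qubit qubit).cone :=
    Submodule.span_le.mpr fun S hS => Submodule.subset_span
      ⟨isBipartiteState_bilinOfMatrix hS, steersFirst_bilinOfMatrix hS,
        steersSecond_bilinOfMatrix hS⟩
  exact hle (positiveMaps_le_hull (bilinOfMatrix_mem_maxTensor.mp hω))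

/-- A product of qubits generated by a class of states containing all bisteering states is the
maximal tensor product. -/
theorem productGeneratedBy_eq_maxTensor
    {P : Bilin (Herm (Fin 2)) (Herm (Fin 2)) → Prop}
    (hP : ∀ ω, SteersFirst qubit qubit ω ∧ SteersSecond qubit qubit ω → P ω) :
    productGeneratedBy qubit qubit P = maxTensor qubit qubit := by
  refine UnitalConeSpace.ext (le_antisymm ?_ ?_) rfl
  · exact Submodule.span_le.mpr fun ω hω => hω.1.1
  · exact maxTensor_cone_le_bisteeringProduct.trans
      (Submodule.span_mono fun ω hω => ⟨hω.1, hP ω hω.2⟩)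

theorem WeaklySelfDual.of_equiv {V W : Type*} [AddCommGroup V] [Module ℝ V] [AddCommGroup W]
    [Module ℝ W] {C : PointedCone ℝ V} {D : PointedCone ℝ W} (e : V ≃ₗ[ℝ] W)
    (he : ∀ x, e x ∈ D ↔ x ∈ C) (h : WeaklySelfDual D) : WeaklySelfDual C := by
  obtain ⟨η, hη⟩ := h
  refine ⟨e.symm.dualMap.trans (η.trans e.symm), fun f => ?_⟩
  rw [← he]
  simp only [LinearEquiv.trans_apply, LinearEquiv.apply_symm_apply, hη]
  constructor
  · intro hf x hx
    have := hf ((he x).mpr hx)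
    simpa using this
  · intro hf y hy
    have := hf ((he (e.symm y)).mp (by simpa using hy))
    simpa using this

theorem not_weaklySelfDual_maxTensor : ¬ WeaklySelfDual (maxTensor qubit qubit).cone :=
  fun h => not_weaklySelfDual_positiveMaps
    (h.of_equiv bilinOfMatrix fun _ => bilinOfMatrix_mem_maxTensor)

end SteeringProduct

theorem mainTheorem11 :
    (SteeringProduct.steeringProduct SteeringProduct.qubit SteeringProduct.qubit =
        SteeringProduct.maxTensor SteeringProduct.qubit SteeringProduct.qubit ∧
      SteeringProduct.eitherSteeringProduct SteeringProduct.qubit SteeringProduct.qubit =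
        SteeringProduct.maxTensor SteeringProduct.qubit SteeringProduct.qubit ∧
      SteeringProduct.bisteeringProduct SteeringProduct.qubit SteeringProduct.qubit =
        SteeringProduct.maxTensor SteeringProduct.qubit SteeringProduct.qubit) ∧
    ¬ SteeringProduct.WeaklySelfDual
        (SteeringProduct.maxTensor SteeringProduct.qubit SteeringProduct.qubit).cone ∧
    ¬ SteeringProduct.WeaklySelfDual
        (SteeringProduct.steeringProduct SteeringProduct.qubit SteeringProduct.qubit).cone ∧
    ¬ SteeringProduct.WeaklySelfDual
        (SteeringProduct.eitherSteeringProduct SteeringProduct.qubit SteeringProduct.qubit).cone ∧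
    ¬ SteeringProduct.WeaklySelfDual
        (SteeringProduct.bisteeringProduct SteeringProduct.qubit SteeringProduct.qubit).cone := by
  have h1 : SteeringProduct.steeringProduct SteeringProduct.qubit SteeringProduct.qubit = _ :=
    SteeringProduct.productGeneratedBy_eq_maxTensor fun _ h => h.2
  have h2 : SteeringProduct.eitherSteeringProduct SteeringProduct.qubit SteeringProduct.qubit = _ :=
    SteeringProduct.productGeneratedBy_eq_maxTensor fun _ h => Or.inl h.1
  have h3 : SteeringProduct.bisteeringProduct SteeringProduct.qubit SteeringProduct.qubit = _ :=
    SteeringProduct.productGeneratedBy_eq_maxTensor fun _ h => h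
  have h4 := SteeringProduct.not_weaklySelfDual_maxTensor
  exact ⟨⟨h1, h2, h3⟩, h4, h1 ▸ h4, h2 ▸ h4, h3 ▸ h4⟩
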